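/- Let $(M,\omega)$ be a symplectic 4-manifold (smooth, Hausdorff, second countable) with $c_1(M)=c_1(TM)=0\in H^2(M,\mathbb Z)$ and $H^1(M,\mathbb R)=0$. For an embedded Lagrangian torus $L\subset M$, let $\mu\in H^1(L,\mathbb Z)=\mathrm{Hom}(H_1(L,\mathbb Z),\mathbb Z)$ be its Maslov class: for an $\omega$-compatible almost complex structure $J$ on $M$ and a nowhere vanishing continuous section $s$ of $\Lambda^2_{\mathbb C}T^*M$ (these exist, and $\mu$ does not depend on them), $\mu(\eta)$ is the degree along $\eta\in H_1(L,\mathbb Z)$ of the map $L\to S^1$, $x\mapsto s(u,v)^2/|s(u,v)|^2$, where $u,v$ is any basis of $T_xL$. Let $m_L\ge 0$ be the integer with $\mu(H_1(L,\mathbb Z))=m_L\mathbb Z$. The torus $L$ is called *monotone* if $\mu\neq0$ and there are a 1-form $\lambda$ with $d\lambda=\omega$ on a neighbourhood of $L$ and a real number $c\ne 0$ such that the class $\alpha=[\lambda|_L]\in H^1(L,\mathbb R)$ satisfies $\alpha=c\mu\ne 0$. Let $\mathrm{Ham}(M)$ be the set of symplectomorphisms of $M$ that are time one maps of compactly supported,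 smooth, time dependent Hamiltonian vector fields, and let $$\mathcal H_L=\{\phi_*\in \mathrm{Aut}(H_1(L,\mathbb Z)) : \phi\in\mathrm{Ham}(M),\ \phi(L)=L\}.$$ For a monotone Lagrangian torus $L$ choose a basis $\gamma,\sigma$ of $H_1(L,\mathbb Z)$ such that $\mu(\gamma)$ is the least positive value of $\mu$ and $\mu(\sigma)=0$, and for $k\in\mathbb Z$ let $g_k$ be the automorphism with $g_k(\gamma)=\gamma+k\sigma$, $g_k(\sigma)=\sigma$. An element of $\mathcal H_L$ is called a *twist* if it has infinite order and an *involution* if it has order 2. The *twist number* of $L$ is $$t(L)=\min\{k>0 : g_k \text{ is a twist in } \mathcal H_L\},$$ or $t(L)=0$ if $\mathcal H_L$ contains no twist (this does not depend on the choice of the basis). For an involution $f\in\mathcal H_L$ the group $\{\eta\in H_1(L,\mathbb Z): f(\eta)=\eta\}$ has a unique generator $\eta_f$ with $\mu(\eta_f)>0$; put $m_f=\mu(\eta_f)/m_L\in\mathbb N$. The *spectrum* of $L$ is $$s(L)=\min\{m_f : f\in\mathcal H_L \text{ an involution}\},$$ or $s(L)=0$ if $\mathcal H_L$ contains no involution.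 **Lemma.** The numbers $t(L)$ and $s(L)$ are invariant under Hamiltonian isotopy: let $L_0,L_1\subset M$ be monotone Lagrangian tori, and suppose that there is a smooth isotopy $(\phi_t)_{t\in[0,1]}$ with compact support and with $\phi_t\in\mathrm{Ham}(M)$ for all $t$, $\phi_0=\mathrm{id}$ and $\phi_1(L_0)=L_1$. Then $t(L_0)=t(L_1)$ and $s(L_0)=s(L_1)$. -/

import Mathlib

open scoped Manifold ContDiff Bundle
open CategoryTheory

universe u

noncomputable section

namespace LagrangianMonodromy

/-! ### Singular homology and cohomology in degree one -/

section Homology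

open scoped Simplicial

/-- The singular simplicial set of a topological space. -/
abbrev Sing (X : Type u) [TopologicalSpace X] : SSet.{u} :=
  TopCat.toSSet.obj (TopCat.of X)

/-- The coefficient group `ℤ`, lifted to the universe `u`. -/
abbrev IntCoeff : ModuleCat.{u} ℤ := ModuleCat.of ℤ (ULift.{u} ℤ)

/-- The integral singular chain complex. -/
abbrev SingChains (X : Type u) [TopologicalSpace X] : ChainComplex (ModuleCat.{u} ℤ) ℕ :=
  (Sing X).chainComplex IntCoeff

/-- The first singular homology group `H₁(X; ℤ)`. -/
abbrev H1 (X : Type u) [TopologicalSpace X] : ModuleCat.{u} ℤ :=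
  (Sing X).homology IntCoeff 1

/-- The map `f_* : H₁(X; ℤ) → H₁(Y; ℤ)` induced by a continuous map. -/
def H1map {X Y : Type u} [TopologicalSpace X] [TopologicalSpace Y] (f : C(X, Y)) :
    H1 X →ₗ[ℤ] H1 Y :=
  (SSet.homologyMap (TopCat.toSSet.map (TopCat.ofHom f)) IntCoeff 1).hom

/-- The standard `1`-simplex (pairs `(p₀, p₁)` with `p₀, p₁ ≥ 0`, `p₀ + p₁ = 1`). -/
abbrev Edge : Type := stdSimplex ℝ (Fin 2)

/-- The basis element of the group of singular `1`-chains given by a singular `1`-simplex. -/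
def edgeChain {X : Type u} [TopologicalSpace X] (σ : C(Edge, X)) : (SingChains X).X 1 :=
  ((Sing X).ιChainComplex (R := IntCoeff) (n := 1)
    ((TopCat.toSSetObjEquiv (TopCat.of X) (.op ⦋1⦌)).symm σ)).hom (ULift.up 1)

/-- The homomorphism `a : H₁(X; ℤ) → ℝ` is given by the real `1`-cochain `D`: the value of `a`
on the class of a `1`-cycle `z` is `D z`. -/
def IsRepresentedBy {X : Type u} [TopologicalSpace X] (a : H1 X →ₗ[ℤ] ℝ)
    (D : (SingChains X).X 1 →ₗ[ℤ] ℝ) : Prop :=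
  ∀ z : (SingChains X).cycles 1,
    a (((SingChains X).homologyπ 1).hom z) = D (((SingChains X).iCycles 1).hom z)

/-- `H¹(X; ℝ) = 0`: every real singular `1`-cocycle is a coboundary. -/
def RealH1Vanishes (X : Type u) [TopologicalSpace X] : Prop :=
  ∀ c : (Sing X) _⦋1⦌ → ℝ,
    (∀ τ : (Sing X) _⦋2⦌,
      c ((Sing X).δ 0 τ) - c ((Sing X).δ 1 τ) + c ((Sing X).δ 2 τ) = 0) →
    ∃ f : (Sing X) _⦋0⦌ → ℝ, ∀ σ : (Sing X) _⦋1⦌,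
      c σ = f ((Sing X).δ 0 σ) - f ((Sing X).δ 1 σ)

end Homology

/-! ### Differential forms and symplectic structures on 4-manifolds -/

/-- The model space of 4-manifolds. -/
abbrev E4 : Type := EuclideanSpace ℝ (Fin 4)

section Forms

variable {M : Type u} [TopologicalSpace M] [ChartedSpace E4 M] [IsManifold (𝓡 4) ∞ M]

variable (M) in
/-- Real 1-forms, not necessarily continuous. -/
abbrev OneForm : Type u := ∀ x : M, TangentSpace (𝓡 4) x →L[ℝ] ℝ

variable (M) in
/-- Real bilinear forms on the tangent spaces, not necessarily continuous in the base point. -/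
abbrev BilinForm : Type u :=
  ∀ x : M, TangentSpace (𝓡 4) x →L[ℝ] TangentSpace (𝓡 4) x →L[ℝ] ℝ

variable (M) in
/-- Complex valued real-bilinear forms on the tangent spaces. -/
abbrev ComplexBilinForm : Type u :=
  ∀ x : M, TangentSpace (𝓡 4) x →L[ℝ] TangentSpace (𝓡 4) x →L[ℝ] ℂ

/-- Smoothness of a 1-form on a set. -/
def OneForm.SmoothOn (l : OneForm M) (U : Set M) : Prop :=
  ContMDiffOn (𝓡 4) ((𝓡 4).prod 𝓘(ℝ, E4 →L[ℝ] ℝ)) ∞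
    (fun x => Bundle.TotalSpace.mk' (E4 →L[ℝ] ℝ)
      (E := fun x : M => TangentSpace (𝓡 4) x →L[ℝ] ℝ) x (l x)) U

/-- Smoothness of a field of bilinear forms. -/
def BilinForm.Smooth (w : BilinForm M) : Prop :=
  ContMDiff (𝓡 4) ((𝓡 4).prod 𝓘(ℝ, E4 →L[ℝ] E4 →L[ℝ] ℝ)) ∞
    (fun x => Bundle.TotalSpace.mk' (E4 →L[ℝ] E4 →L[ℝ] ℝ)
      (E := fun x : M => TangentSpace (𝓡 4) x →L[ℝ] TangentSpace (𝓡 4) x →L[ℝ] ℝ) x (w x))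

/-- Continuity on a set of a field of complex valued bilinear forms. -/
def ComplexBilinForm.ContOn (s : ComplexBilinForm M) (U : Set M) : Prop :=
  ContinuousOn
    (fun x => Bundle.TotalSpace.mk' (E4 →L[ℝ] E4 →L[ℝ] ℂ)
      (E := fun x : M => TangentSpace (𝓡 4) x →L[ℝ] TangentSpace (𝓡 4) x →L[ℝ] ℂ) x (s x)) U

/-- The coordinate vector field with constant coefficients `v` in the chart around `p`, at the
point with coordinates `y`. -/
def coordVector (p : M) (v y : E4) : TangentSpace (𝓡 4) ((extChartAt (𝓡 4) p).symm y) :=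
  mfderiv 𝓘(ℝ, E4) (𝓡 4) (extChartAt (𝓡 4) p).symm y v

/-- The coefficient `l(v)` of a 1-form in the chart around `p`, as a function of coordinates. -/
def OneForm.coeff (l : OneForm M) (p : M) (v : E4) : E4 → ℝ := fun y =>
  l ((extChartAt (𝓡 4) p).symm y) (coordVector p v y)

/-- The coefficient `w(u, v)` of a 2-form in the chart around `p`, as a function of
coordinates. -/
def BilinForm.coeff (w : BilinForm M) (p : M) (u v : E4) : E4 → ℝ := fun y =>
  w ((extChartAt (𝓡 4) p).symm y) (coordVector p u y) (coordVector p v y)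

/-- `dw = 0`, computed in charts. -/
def BilinForm.Closed (w : BilinForm M) : Prop :=
  ∀ p : M, ∀ y ∈ (extChartAt (𝓡 4) p).target, ∀ u₁ u₂ u₃ : E4,
    fderiv ℝ (w.coeff p u₂ u₃) y u₁ + fderiv ℝ (w.coeff p u₃ u₁) y u₂
      + fderiv ℝ (w.coeff p u₁ u₂) y u₃ = 0

/-- `w = dl` on the open set `U`, computed in charts. -/
def OneForm.IsPrimitiveOn (l : OneForm M) (w : BilinForm M) (U : Set M) : Prop :=
  ∀ p : M, ∀ y ∈ (extChartAt (𝓡 4) p).target, (extChartAt (𝓡 4) p).symm y ∈ U → ∀ u v : E4,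
    fderiv ℝ (l.coeff p v) y u - fderiv ℝ (l.coeff p u) y v = w.coeff p u v y

/-- A symplectic form: a smooth, closed, nondegenerate, alternating 2-form. -/
structure IsSymplectic (w : BilinForm M) : Prop where
  smooth : w.Smooth
  alternating : ∀ x v, w x v v = 0
  closed : w.Closed
  nondegenerate : ∀ x v, (∀ v', w x v v' = 0) → v = 0

end Forms

/-! ### Almost complex structures and the first Chern class -/

section Complex

variable {M : Type u} [TopologicalSpace M] [ChartedSpace E4 M] [IsManifold (𝓡 4) ∞ M]

/-- A smooth almost complex structure `J` that is compatible with `w`, i.e. `w(J·, J·) = w` and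
`w(v, Jv) > 0` for `v ≠ 0`. -/
structure IsCompatible (w : BilinForm M)
    (J : ∀ x : M, TangentSpace (𝓡 4) x →L[ℝ] TangentSpace (𝓡 4) x) : Prop where
  smooth : ContMDiff (𝓡 4) ((𝓡 4).prod 𝓘(ℝ, E4 →L[ℝ] E4)) ∞
    (fun x => Bundle.TotalSpace.mk' (E4 →L[ℝ] E4)
      (E := fun x : M => TangentSpace (𝓡 4) x →L[ℝ] TangentSpace (𝓡 4) x) x (J x))
  sq : ∀ x v, J x (J x v) = -v
  invariant : ∀ x u v, w x (J x u) (J x v) = w x u v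
  positive : ∀ x v, v ≠ 0 → 0 < w x v (J x v)

/-- `s` is a continuous nowhere vanishing section over `U` of the canonical line bundle
`Λ²_ℂ T*M` of `(TM, J)`: an alternating, `J`-complex bilinear form. -/
structure IsNonvanishingSection
    (J : ∀ x : M, TangentSpace (𝓡 4) x →L[ℝ] TangentSpace (𝓡 4) x)
    (U : Set M) (s : ComplexBilinForm M) : Prop where
  continuousOn : s.ContOn U
  alternating : ∀ x ∈ U, ∀ v, s x v v = 0
  complexLinear : ∀ x ∈ U, ∀ u v, s x (J x u) v = Complex.I * s x u v
  nonvanishing : ∀ x ∈ U, ∃ u v, s x u v ≠ 0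

/-- The first Chern class of `(M, w)` vanishes. The class `-c₁(TM, J)` is the first Chern class
of the line bundle `Λ²_ℂ T*M`, i.e. the image of that bundle under the connecting map of the
exponential sequence. For local nonvanishing sections `s i` over an open cover
with transition functions `exp (2πi h i j)`, it is the class in Čech cohomology with integer
coefficients of the 2-cocycle `h j k - h i k + h i j`. This class is zero if (after passing to a
suitable cover) the cocycle is the coboundary of an integral 1-cochain `n`. The class does not
depend on the choice of `J`. -/
def FirstChernClassVanishes (w : BilinForm M) : Prop :=
  ∃ J : ∀ x : M, TangentSpace (𝓡 4) x →L[ℝ] TangentSpace (𝓡 4) x, IsCompatible w J ∧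
  ∃ (ι : Type u) (U : ι → Set M) (s : ι → ComplexBilinForm M)
    (h : ι → ι → M → ℂ) (n : ι → ι → M → ℤ),
    (∀ i, IsOpen (U i)) ∧ (⋃ i, U i) = Set.univ ∧
    (∀ i, IsNonvanishingSection J (U i) (s i)) ∧
    (∀ i j, ContinuousOn (h i j) (U i ∩ U j)) ∧
    (∀ i j, ∀ x ∈ U i ∩ U j, ∀ u v,
      s j x u v = Complex.exp (2 * Real.pi * Complex.I * h i j x) * s i x u v) ∧
    (∀ i j, ContinuousOn (n i j) (U i ∩ U j)) ∧
    (∀ i j k, ∀ x ∈ U i ∩ U j ∩ U k,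
      h j k x - h i k x + h i j x = ((n j k x - n i k x + n i j x : ℤ) : ℂ))

end Complex

/-! ### Lagrangian tori, the Maslov class, the action class, monotonicity -/

section Lagrangian

variable {M : Type u} [TopologicalSpace M] [ChartedSpace E4 M] [IsManifold (𝓡 4) ∞ M]

/-- `v` is tangent at `x` to `L`: it is the velocity of a smooth curve in `L` through `x`. -/
def IsTangentTo (L : Set M) (x : M) (v : TangentSpace (𝓡 4) x) : Prop :=
  ∃ c : ℝ → M, ContMDiff 𝓘(ℝ, ℝ) (𝓡 4) ∞ c ∧ (∀ t, c t ∈ L) ∧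
    tangentMap 𝓘(ℝ, ℝ) (𝓡 4) c ⟨0, (1 : ℝ)⟩ = ⟨x, v⟩

/-- `L` is an embedded Lagrangian torus. -/
def IsLagrangianTorus (w : BilinForm M) (L : Set M) : Prop :=
  (∃ e : Circle × Circle → M,
    Manifold.IsSmoothEmbedding ((𝓡 1).prod (𝓡 1)) (𝓡 4) ∞ e ∧ Set.range e = L) ∧
  ∀ x ∈ L, ∀ u v, IsTangentTo L x u → IsTangentTo L x v → w x u v = 0

/-- `μ` is the Maslov class of `L`, computed from a compatible almost complex structure `J` and a
nowhere vanishing section `s` of `Λ²_ℂ T*M`: if `θ : L → S¹` is the squared phase of `s` on the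
tangent planes of `L`, `θ = s(u, v)² / |s(u, v)|²` for any basis `u, v`, then `μ` assigns to a cycle the winding number of `θ` along it. Here the
total variation of `θ` along a path is measured by a continuous lift to `ℝ`, in full turns.
If `c₁ = 0` and `H¹(M; ℝ) = 0` then `J` and `s` exist and `μ` does not depend on them. -/
def IsMaslovClass (w : BilinForm M) (L : Set M) (μ : H1 L →ₗ[ℤ] ℤ) : Prop :=
  ∃ (J : ∀ x : M, TangentSpace (𝓡 4) x →L[ℝ] TangentSpace (𝓡 4) x) (s : ComplexBilinForm M)
    (θ : C(L, Circle)) (D : (SingChains L).X 1 →ₗ[ℤ] ℝ),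
    IsCompatible w J ∧ IsNonvanishingSection J Set.univ s ∧
    (∀ (x : L) (u v : TangentSpace (𝓡 4) (x : M)), IsTangentTo L x u → IsTangentTo L x v →
      LinearIndependent ℝ ![u, v] → (θ x : ℂ) = (s x u v / ‖s x u v‖) ^ 2) ∧
    (∀ σ : C(Edge, L), ∃ f : C(Edge, ℝ), (∀ p, Circle.exp (2 * Real.pi * f p) = θ (σ p)) ∧
      D (edgeChain σ) = f (stdSimplex.vertex 1) - f (stdSimplex.vertex 0)) ∧
    IsRepresentedBy ((Int.castAddHom ℝ).toIntLinearMap ∘ₗ μ) D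

open Classical in
/-- The Maslov class `μ ∈ H¹(L; ℤ) = Hom(H₁(L; ℤ), ℤ)`. -/
def maslovClass (w : BilinForm M) (L : Set M) : H1 L →ₗ[ℤ] ℤ :=
  if h : ∃ μ, IsMaslovClass w L μ then h.choose else 0

/-- `a ∈ H¹(L; ℝ) = Hom(H₁(L; ℤ), ℝ)` is the class of the restriction to `L` of the
1-form `l`: it is represented by a cochain that integrates `l` over smooth paths in `L`. -/
def IsRestrictedClass (l : OneForm M) (L : Set M) (a : H1 L →ₗ[ℤ] ℝ) : Prop :=
  ∃ D : (SingChains L).X 1 →ₗ[ℤ] ℝ,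
    (∀ (σ : C(Edge, L)) (c : ℝ → M), ContMDiff 𝓘(ℝ, ℝ) (𝓡 4) ∞ c → (∀ t, c t ∈ L) →
      (∀ p : Edge, (σ p : M) = c (p.1 1)) →
      D (edgeChain σ) = ∫ t in (0 : ℝ)..1, l (c t) (mfderiv 𝓘(ℝ, ℝ) (𝓡 4) c t (1 : ℝ))) ∧
    IsRepresentedBy a D

/-- `α ∈ H¹(L; ℝ)` is an action class of `L`: the class of the restriction to `L` of a
primitive of `w` defined near `L`. -/
def IsActionClass (w : BilinForm M) (L : Set M) (α : H1 L →ₗ[ℤ] ℝ) : Prop :=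
  ∃ (U : Set M) (l : OneForm M), IsOpen U ∧ L ⊆ U ∧ l.SmoothOn U ∧ l.IsPrimitiveOn w U ∧
    IsRestrictedClass l L α

/-- `L` is a monotone Lagrangian torus: `μ ≠ 0`, `α ≠ 0` and `α = c μ` for some `c ≠ 0`. -/
structure IsMonotoneLagrangianTorus (w : BilinForm M) (L : Set M) : Prop where
  lagrangian : IsLagrangianTorus w L
  maslov_ne_zero : maslovClass w L ≠ 0
  monotone : ∃ α : H1 L →ₗ[ℤ] ℝ, IsActionClass w L α ∧ α ≠ 0 ∧
    ∃ c : ℝ, c ≠ 0 ∧ ∀ η, α η = c * (maslovClass w L η : ℝ)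

end Lagrangian

/-! ### Hamiltonian diffeomorphisms and the monodromy group -/

section Hamiltonian

variable {M : Type u} [TopologicalSpace M] [ChartedSpace E4 M] [IsManifold (𝓡 4) ∞ M]

/-- `Ham(M)`: the symplectomorphisms `φ` that are the time one map of the vector field `X t` of a
smooth time dependent Hamiltonian `H t`, `0 ≤ t ≤ 1`, with `X` compactly supported. -/
def Ham (w : BilinForm M) : Set (M ≃ₘ^∞⟮𝓡 4, 𝓡 4⟯ M) :=
  {φ | (∀ x u v, w (φ x) (mfderiv (𝓡 4) (𝓡 4) φ x u) (mfderiv (𝓡 4) (𝓡 4) φ x v) = w x u v) ∧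
    ∃ (H : ℝ → M → ℝ) (X : ℝ → ∀ x : M, TangentSpace (𝓡 4) x) (F : ℝ → M → M) (K : Set M),
      ContMDiffOn (𝓘(ℝ, ℝ).prod (𝓡 4)) 𝓘(ℝ, ℝ) ∞ (fun q : ℝ × M => H q.1 q.2)
        (Set.Icc 0 1 ×ˢ Set.univ) ∧
      (∀ t ∈ Set.Icc (0 : ℝ) 1, ∀ x v, w x (X t x) v = mfderiv (𝓡 4) 𝓘(ℝ, ℝ) (H t) x v) ∧
      IsCompact K ∧ (∀ t ∈ Set.Icc (0 : ℝ) 1, ∀ x ∉ K, X t x = 0) ∧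
      (∀ x, F 0 x = x) ∧
      (∀ x, ∀ t ∈ Set.Icc (0 : ℝ) 1,
        HasMFDerivWithinAt 𝓘(ℝ, ℝ) (𝓡 4) (fun r => F r x) (Set.Icc 0 1) t
          ((1 : ℝ →L[ℝ] ℝ).smulRight (X t (F t x)))) ∧
      ∀ x, F 1 x = φ x}

/-- `L₀` and `L₁` are Hamiltonian isotopic: there is a compactly supported smooth isotopy `Φ t`,
`0 ≤ t ≤ 1`, of Hamiltonian diffeomorphisms with `Φ 0 = id` and `Φ 1 (L₀) = L₁`. -/
def HamiltonianIsotopic (w : BilinForm M) (L₀ L₁ : Set M) : Prop :=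
  ∃ Φ : ℝ → (M ≃ₘ^∞⟮𝓡 4, 𝓡 4⟯ M),
    ContMDiffOn (𝓘(ℝ, ℝ).prod (𝓡 4)) (𝓡 4) ∞ (fun q : ℝ × M => Φ q.1 q.2)
      (Set.Icc 0 1 ×ˢ Set.univ) ∧
    (∃ K : Set M, IsCompact K ∧ ∀ t ∈ Set.Icc (0 : ℝ) 1, ∀ x ∉ K, Φ t x = x) ∧
    (∀ t ∈ Set.Icc (0 : ℝ) 1, Φ t ∈ Ham w) ∧
    (∀ x, Φ 0 x = x) ∧ Φ 1 '' L₀ = L₁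

/-- `Ham(M, L)`: the Hamiltonian diffeomorphisms with `φ(L) = L`. -/
def HamPreserving (w : BilinForm M) (L : Set M) : Set (M ≃ₘ^∞⟮𝓡 4, 𝓡 4⟯ M) :=
  {φ | φ ∈ Ham w ∧ φ '' L = L}

/-- The restriction to `L` of a diffeomorphism that maps `L` to itself. -/
def restrictTo (φ : M ≃ₘ^∞⟮𝓡 4, 𝓡 4⟯ M) (L : Set M) (h : φ '' L = L) : C(L, L) :=
  ⟨(Set.mapsTo_iff_image_subset.2 h.subset).restrict,
    φ.continuous.restrict (Set.mapsTo_iff_image_subset.2 h.subset)⟩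

/-- The Hamiltonian monodromy group of `L`, as a set of automorphisms of `H₁(L; ℤ)`. -/
def monodromy (w : BilinForm M) (L : Set M) : Set (H1 L ≃ₗ[ℤ] H1 L) :=
  {g | ∃ φ ∈ HamPreserving w L, ∃ h : φ '' L = L,
    (g : H1 L →ₗ[ℤ] H1 L) = H1map (restrictTo φ L h)}

end Hamiltonian

/-! ### Twist number and spectrum -/

section Algebra

variable {A : Type u} [AddCommGroup A] [Module ℤ A]

/-- The divisibility `m ≥ 0` of `μ : A → ℤ`, determined by `μ(A) = mℤ`. -/
def divisibility (μ : A →ₗ[ℤ] ℤ) : ℕ :=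
  (Submodule.IsPrincipal.generator (LinearMap.range μ)).natAbs

/-- An involution: an element of order two. -/
def IsInvolution (f : A ≃ₗ[ℤ] A) : Prop := f * f = 1 ∧ f ≠ 1

/-- A twist: an element of infinite order. -/
def IsTwist (f : A ≃ₗ[ℤ] A) : Prop := ∀ n : ℕ, 0 < n → f ^ n ≠ 1

/-- A basis `γ = b 0`, `σ = b 1` with `μ(γ)` the least positive value of `μ` and `μ(σ) = 0`. -/
def IsAdaptedBasis (μ : A →ₗ[ℤ] ℤ) (b : Module.Basis (Fin 2) ℤ A) : Prop :=
  IsLeast {m : ℤ | 0 < m ∧ ∃ η, μ η = m} (μ (b 0)) ∧ μ (b 1) = 0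

/-- `g` is the map `g_k`: `γ ↦ γ + kσ`, `σ ↦ σ`. -/
def IsStandardTwist (b : Module.Basis (Fin 2) ℤ A) (k : ℤ) (g : A ≃ₗ[ℤ] A) : Prop :=
  g (b 0) = b 0 + k • b 1 ∧ g (b 1) = b 1

/-- The least `k > 0` such that `g_k` is a twist in `G`, and `0` if there is none (the infimum of
the empty set of natural numbers is `0`). Other adapted bases only replace `g_k` by `g_{-k}`. -/
def twistNumberOf (μ : A →ₗ[ℤ] ℤ) (G : Set (A ≃ₗ[ℤ] A)) : ℕ :=
  sInf {k : ℕ | 0 < k ∧ ∃ b, IsAdaptedBasis μ b ∧ ∃ g ∈ G, IsTwist g ∧ IsStandardTwist b k g}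

/-- `m = m_f`: the fixed lattice of `f` is generated by some `η` with `μ(η) > 0`, and
`m = μ(η) / m_L` where `m_L` is the divisibility of `μ`. -/
def IsMaslovNumberOf (μ : A →ₗ[ℤ] ℤ) (f : A ≃ₗ[ℤ] A) (m : ℕ) : Prop :=
  ∃ η : A, {x : A | f x = x} = (Submodule.span ℤ {η} : Set A) ∧ 0 < μ η ∧
    μ η = m * divisibility μ

/-- The least `m_f` of the involutions `f` in `G`, and `0` if there is none. -/
def spectrumOf (μ : A →ₗ[ℤ] ℤ) (G : Set (A ≃ₗ[ℤ] A)) : ℕ :=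
  sInf {m : ℕ | ∃ f ∈ G, IsInvolution f ∧ IsMaslovNumberOf μ f m}

end Algebra

section Invariants

variable {M : Type u} [TopologicalSpace M] [ChartedSpace E4 M] [IsManifold (𝓡 4) ∞ M]

/-- The twist number `t(L)`. -/
def twistNumber (w : BilinForm M) (L : Set M) : ℕ :=
  twistNumberOf (maslovClass w L) (monodromy w L)

/-- The spectrum `s(L)`. -/
def spectrumNumber (w : BilinForm M) (L : Set M) : ℕ :=
  spectrumOf (maslovClass w L) (monodromy w L)

end Invariants

end LagrangianMonodromy

end

/-! Both numbers are read off from the triple consisting of `H1 L`, the Maslov class and the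
monodromy group, so it suffices that the time one map `ψ` of the isotopy induces an isomorphism of
triples. On the groups this is conjugation: for symplectic `ψ`, a Hamiltonian diffeomorphism `φ`
preserving `L₀` becomes `ψ φ ψ⁻¹`, which preserves `L₁` and is Hamiltonian because `ψ` carries the
Hamiltonian vector field of `H` to that of `H ∘ ψ⁻¹` (`conj_mem_Ham`, `conj_mem_monodromy`).

The substance lies in the Maslov class. Data `(J₁, s₁)` computing it on `L₁` pull back under `ψ` to
data computing it on `L₀`, but these are not the data chosen for `L₀`. Hence independence of the
choices is needed (`maslovClass_unique`), and it is obtained without connecting the two almost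
complex structures by a path. The `(2, 0)`-part of `s₁` with respect to `J₀` equals `ρ s₀` for a
continuous function `ρ` on `M`. On every Lagrangian plane the quotient of this `(2, 0)`-part by `s₁`
avoids the closed negative real axis (`twoZeroPart_div_mem_slitPlane`). This makes `ρ` nowhere zero,
and along `L` the quotient has a continuous argument. So the two squared phases on `L` differ by the
square of the phase of `ρ`, which is defined on all of `M`, and by the exponential of a real
function. The first has coboundary variation since `H¹(M; ℝ) = 0`, the second trivially, so the
winding numbers on cycles agree. -/

noncomputable section

namespace LagrangianMonodromy

/-! ### Transport of the algebraic invariants along an isomorphism -/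

section Transport

variable {A B : Type u} [AddCommGroup A] [Module ℤ A] [AddCommGroup B] [Module ℤ B]

/-- Conjugation of an automorphism by a linear equivalence. -/
abbrev conjEquiv (T : A ≃ₗ[ℤ] B) (g : A ≃ₗ[ℤ] A) : B ≃ₗ[ℤ] B := T.symm ≪≫ₗ g ≪≫ₗ T

lemma conjEquiv_pow_apply (T : A ≃ₗ[ℤ] B) (g : A ≃ₗ[ℤ] A) (n : ℕ) (a : A) :
    (conjEquiv T g ^ n) (T a) = T ((g ^ n) a) := by
  induction n generalizing a with
  | zero => rfl
  | succ n ih =>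
    rw [pow_succ, pow_succ, LinearEquiv.mul_apply, LinearEquiv.mul_apply, ← ih]
    simp [conjEquiv]

/-- Serves both kinds of elements: all exponents `n > 0` for twists, `n = 1` and `n = 2` for
involutions. -/
lemma conjEquiv_pow_eq_one_iff (T : A ≃ₗ[ℤ] B) (g : A ≃ₗ[ℤ] A) (n : ℕ) :
    conjEquiv T g ^ n = 1 ↔ g ^ n = 1 := by
  constructor
  · intro h
    ext a
    apply T.injective
    rw [← conjEquiv_pow_apply, h]
    rfl
  · intro h
    ext b
    obtain ⟨a, rfl⟩ := T.surjective b
    rw [conjEquiv_pow_apply, h]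
    rfl

lemma IsTwist.conj (T : A ≃ₗ[ℤ] B) {g : A ≃ₗ[ℤ] A} (hg : IsTwist g) : IsTwist (conjEquiv T g) :=
  fun n hn h => hg n hn ((conjEquiv_pow_eq_one_iff T g n).1 h)

lemma IsInvolution.conj (T : A ≃ₗ[ℤ] B) {g : A ≃ₗ[ℤ] A} (hg : IsInvolution g) :
    IsInvolution (conjEquiv T g) := by
  have h1 := conjEquiv_pow_eq_one_iff T g 1
  have h2 := conjEquiv_pow_eq_one_iff T g 2
  rw [pow_one, pow_one] at h1
  rw [pow_two, pow_two] at h2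
  exact ⟨h2.2 hg.1, fun h => hg.2 (h1.1 h)⟩

variable {μ : A →ₗ[ℤ] ℤ} {ν : B →ₗ[ℤ] ℤ} (T : A ≃ₗ[ℤ] B)

lemma range_eq_of_comp (h : ∀ a, ν (T a) = μ a) : LinearMap.range ν = LinearMap.range μ := by
  ext m
  constructor
  · rintro ⟨b, rfl⟩
    exact ⟨T.symm b, by rw [← h, T.apply_symm_apply]⟩
  · rintro ⟨a, rfl⟩
    exact ⟨T a, h a⟩

lemma divisibility_eq_of_comp (h : ∀ a, ν (T a) = μ a) : divisibility ν = divisibility μ := by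
  -- The generator depends on a principality instance, so the instances are generalised along with
  -- the submodules before substituting.
  have key : ∀ (S S' : Submodule ℤ ℤ) [S.IsPrincipal] [S'.IsPrincipal], S = S' →
      Submodule.IsPrincipal.generator S = Submodule.IsPrincipal.generator S' := by
    rintro S S' _ _ rfl
    rfl
  exact congrArg Int.natAbs (key _ _ (range_eq_of_comp T h))

lemma IsAdaptedBasis.map (h : ∀ a, ν (T a) = μ a) {b : Module.Basis (Fin 2) ℤ A}
    (hb : IsAdaptedBasis μ b) : IsAdaptedBasis ν (b.map T) := by
  have hset : {m : ℤ | 0 < m ∧ ∃ η, ν η = m} = {m : ℤ | 0 < m ∧ ∃ η, μ η = m} := by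
    ext m
    have := congrArg (fun S : Submodule ℤ ℤ => m ∈ S) (range_eq_of_comp T h)
    simp only [LinearMap.mem_range, eq_iff_iff] at this
    simp only [Set.mem_ofPred_eq, this]
  refine ⟨?_, ?_⟩
  · rw [hset, Module.Basis.map_apply, h]
    exact hb.1
  · rw [Module.Basis.map_apply, h]
    exact hb.2

lemma IsStandardTwist.map {b : Module.Basis (Fin 2) ℤ A} {k : ℤ} {g : A ≃ₗ[ℤ] A}
    (hg : IsStandardTwist b k g) : IsStandardTwist (b.map T) k (conjEquiv T g) := by
  refine ⟨?_, ?_⟩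
  · simp [conjEquiv, hg.1]
  · simp [conjEquiv, hg.2]

lemma IsMaslovNumberOf.map (h : ∀ a, ν (T a) = μ a) {f : A ≃ₗ[ℤ] A} {m : ℕ}
    (hf : IsMaslovNumberOf μ f m) : IsMaslovNumberOf ν (conjEquiv T f) m := by
  obtain ⟨η, hη, hpos, hm⟩ := hf
  refine ⟨T η, ?_, by rwa [h], ?_⟩
  · ext b
    obtain ⟨a, rfl⟩ := T.surjective b
    have ha := congrArg (fun S : Set A => a ∈ S) hη
    simp only [Set.mem_ofPred_eq, SetLike.mem_coe, Submodule.mem_span_singleton, eq_iff_iff] at ha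
    simp only [Set.mem_ofPred_eq, SetLike.mem_coe, Submodule.mem_span_singleton, conjEquiv,
      LinearEquiv.trans_apply, T.symm_apply_apply, T.injective.eq_iff, ha, ← T.map_smul]
  · rw [h, hm, divisibility_eq_of_comp T h]

variable {G : Set (A ≃ₗ[ℤ] A)} {H : Set (B ≃ₗ[ℤ] B)}

lemma symm_comp_of_comp (h : ∀ a, ν (T a) = μ a) (b : B) : μ (T.symm b) = ν b := by
  rw [← h, T.apply_symm_apply]

/-- The twist number only depends on the isomorphism class of `(A, μ, G)`. -/
lemma twistNumberOf_congr (h : ∀ a, ν (T a) = μ a) (hG : ∀ g ∈ G, conjEquiv T g ∈ H)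
    (hH : ∀ g ∈ H, conjEquiv T.symm g ∈ G) : twistNumberOf μ G = twistNumberOf ν H := by
  unfold twistNumberOf
  congr 1
  ext k
  constructor
  · rintro ⟨hk, b, hb, g, hg, ht, hs⟩
    exact ⟨hk, b.map T, hb.map T h, _, hG g hg, ht.conj T, hs.map T⟩
  · rintro ⟨hk, b, hb, g, hg, ht, hs⟩
    exact ⟨hk, b.map T.symm, hb.map T.symm (symm_comp_of_comp T h), _, hH g hg, ht.conj T.symm,
      hs.map T.symm⟩

/-- The spectrum only depends on the isomorphism class of `(A, μ, G)`. -/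
lemma spectrumOf_congr (h : ∀ a, ν (T a) = μ a) (hG : ∀ g ∈ G, conjEquiv T g ∈ H)
    (hH : ∀ g ∈ H, conjEquiv T.symm g ∈ G) : spectrumOf μ G = spectrumOf ν H := by
  unfold spectrumOf
  congr 1
  ext m
  constructor
  · rintro ⟨f, hf, hi, hm⟩
    exact ⟨_, hG f hf, hi.conj T, hm.map T h⟩
  · rintro ⟨f, hf, hi, hm⟩
    exact ⟨_, hH f hf, hi.conj T.symm, hm.map T.symm (symm_comp_of_comp T h)⟩

end Transport

/-! ### Compatible complex structures on a symplectic vector space -/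

section SymplecticLinearAlgebra

variable {V : Type*} [AddCommGroup V] [Module ℝ V] [TopologicalSpace V]

/-- `J` is a complex structure on `V` compatible with the bilinear form `w`. -/
structure CompatibleAt (w : V →L[ℝ] V →L[ℝ] ℝ) (J : V →L[ℝ] V) : Prop where
  sq : ∀ v, J (J v) = -v
  invariant : ∀ u v, w (J u) (J v) = w u v
  positive : ∀ v, v ≠ 0 → 0 < w v (J v)

/-- `s` is an alternating `J`-complex bilinear form. -/
structure IsComplexAreaForm (J : V →L[ℝ] V) (s : V →L[ℝ] V →L[ℝ] ℂ) : Prop where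
  alternating : ∀ v, s v v = 0
  complexLinear : ∀ u v, s (J u) v = Complex.I * s u v

namespace IsComplexAreaForm

variable {J : V →L[ℝ] V} {s : V →L[ℝ] V →L[ℝ] ℂ} (hs : IsComplexAreaForm J s)

include hs

lemma swap (u v : V) : s u v = -s v u := by
  have h := hs.alternating (u + v)
  simp only [map_add, add_apply, hs.alternating] at h
  linear_combination h

lemma apply_left {u v : V} (a₁ a₂ b₁ b₂ : ℝ) (y : V) :
    s (a₁ • u + a₂ • v + b₁ • J u + b₂ • J v) y =
      (a₁ + Complex.I * b₁) * s u y + (a₂ + Complex.I * b₂) * s v y := by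
  simp only [map_add, map_smul, add_apply, smul_apply,
    hs.complexLinear, Complex.real_smul]
  ring

end IsComplexAreaForm

/-- The vectors `u, v` form a complex basis of `(V, J)`. -/
def IsComplexBasis (J : V →L[ℝ] V) (u v : V) : Prop :=
  ∀ a : V, ∃ a₁ a₂ b₁ b₂ : ℝ, a = a₁ • u + a₂ • v + b₁ • J u + b₂ • J v

lemma isComplexBasis_of_independent (hV : Module.finrank ℝ V = 4) {J : V →L[ℝ] V} {u v : V}
    (h : ∀ a₁ a₂ b₁ b₂ : ℝ, a₁ • u + a₂ • v + b₁ • J u + b₂ • J v = 0 →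
      a₁ = 0 ∧ a₂ = 0 ∧ b₁ = 0 ∧ b₂ = 0) : IsComplexBasis J u v := by
  intro a
  have : FiniteDimensional ℝ V := FiniteDimensional.of_finrank_pos (by omega)
  have hli : LinearIndependent ℝ ![u, v, J u, J v] := by
    rw [Fintype.linearIndependent_iff]
    intro g hg i
    simp only [Fin.sum_univ_four, Matrix.cons_val] at hg
    obtain ⟨h0, h1, h2, h3⟩ := h _ _ _ _ hg
    fin_cases i <;> assumption
  have hspan := hli.span_eq_top_of_card_eq_finrank' (by simp [hV])
  have ha : a ∈ Submodule.span ℝ (Set.range ![u, v, J u, J v]) := hspan ▸ Submodule.mem_top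
  obtain ⟨c, hc⟩ := (Submodule.mem_span_range_iff_exists_fun ℝ).1 ha
  refine ⟨c 0, c 1, c 2, c 3, ?_⟩
  rw [← hc]
  simp [Fin.sum_univ_four]

/-- Inserting a real relation between `u, v, J u, J v` into `s(·, v)` kills the `v` and `J v` terms
and leaves a complex multiple of `s u v`; inserting it into `s(·, u)` isolates the other
coefficient. -/
lemma IsComplexAreaForm.isComplexBasis (hV : Module.finrank ℝ V = 4) {J : V →L[ℝ] V}
    {s : V →L[ℝ] V →L[ℝ] ℂ} (hs : IsComplexAreaForm J s) {u v : V} (huv : s u v ≠ 0) :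
    IsComplexBasis J u v := by
  have key : ∀ a b : ℝ, (a + Complex.I * b : ℂ) = 0 → a = 0 ∧ b = 0 := by
    intro a b h
    have h1 := congrArg Complex.re h
    have h2 := congrArg Complex.im h
    simpa using And.intro h1 h2
  apply isComplexBasis_of_independent hV
  intro a₁ a₂ b₁ b₂ h
  have h1 := hs.apply_left a₁ a₂ b₁ b₂ (u := u) (v := v) v
  have h2 := hs.apply_left a₁ a₂ b₁ b₂ (u := u) (v := v) u
  rw [h, map_zero, zero_apply, hs.alternating, mul_zero, add_zero] at h1
  rw [h, map_zero, zero_apply, hs.alternating, mul_zero, zero_add,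
    hs.swap v u] at h2
  obtain ⟨h3, h4⟩ := key _ _ ((mul_eq_zero.1 h1.symm).resolve_right huv)
  obtain ⟨h5, h6⟩ := key _ _ ((mul_eq_zero.1 h2.symm).resolve_right (neg_ne_zero.2 huv))
  exact ⟨h3, h5, h4, h6⟩

/-- Two complex area forms on a complex plane are proportional. -/
lemma IsComplexAreaForm.proportional (hV : Module.finrank ℝ V = 4) {J : V →L[ℝ] V}
    {s q : V →L[ℝ] V →L[ℝ] ℂ} (hs : IsComplexAreaForm J s) (hq : IsComplexAreaForm J q) {u v : V}
    (huv : s u v ≠ 0) (a b : V) : q a b * s u v = q u v * s a b := by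
  obtain ⟨a₁, a₂, a₃, a₄, ha⟩ := hs.isComplexBasis hV huv a
  obtain ⟨b₁, b₂, b₃, b₄, hb⟩ := hs.isComplexBasis hV huv b
  -- The value at `(a, b)` is the value at `(u, v)` times a complex `2 × 2` determinant that does
  -- not depend on the area form.
  have h1 : ∀ {t : V →L[ℝ] V →L[ℝ] ℂ}, IsComplexAreaForm J t → t a b =
      ((a₁ + Complex.I * a₃) * (b₂ + Complex.I * b₄)
        - (a₂ + Complex.I * a₄) * (b₁ + Complex.I * b₃)) * t u v := by
    intro t ht
    rw [ha, ht.apply_left, ht.swap u b, ht.swap v b, hb, ht.apply_left, ht.apply_left,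
      ht.alternating, ht.alternating, ht.swap v u]
    ring
  rw [h1 hs, h1 hq]
  ring

variable {w : V →L[ℝ] V →L[ℝ] ℝ}

lemma swap_of_alternating (hw : ∀ v, w v v = 0) (u v : V) : w u v = -w v u := by
  have h := hw (u + v)
  simp only [map_add, add_apply, hw] at h
  linarith

lemma CompatibleAt.symm {J : V →L[ℝ] V} (hJ : CompatibleAt w J) (hw : ∀ v, w v v = 0) (u v : V) :
    w u (J v) = w v (J u) := by
  rw [← hJ.invariant, hJ.sq, map_neg, swap_of_alternating hw, neg_neg]

/-- A basis of a Lagrangian plane is a complex basis. -/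
lemma CompatibleAt.isComplexBasis (hV : Module.finrank ℝ V = 4) {J : V →L[ℝ] V}
    (hJ : CompatibleAt w J) (hw : ∀ v, w v v = 0) {u v : V} (hli : LinearIndependent ℝ ![u, v])
    (huv : w u v = 0) : IsComplexBasis J u v := by
  rw [LinearIndependent.pair_iff] at hli
  apply isComplexBasis_of_independent hV
  intro a₁ a₂ b₁ b₂ h
  have hvu : w v u = 0 := by rw [swap_of_alternating hw, huv, neg_zero]
  -- Pair the relation with `y = b₁ u + b₂ v`: the first two terms vanish since the plane is
  -- Lagrangian, and what remains is `w(y, J y)`, which is positive unless `y = 0`.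
  have hy : b₁ • u + b₂ • v = 0 := by
    by_contra hne
    have h1 := hJ.positive _ hne
    have h2 := congrArg (w (b₁ • u + b₂ • v)) h
    simp only [map_add, map_smul, add_apply, smul_apply,
      smul_eq_mul, hw, huv, hvu, map_zero, mul_zero, add_zero, zero_add] at h1 h2
    linarith
  obtain ⟨hb₁, hb₂⟩ := hli _ _ hy
  rw [hb₁, hb₂, zero_smul, zero_smul, add_zero, add_zero] at h
  obtain ⟨ha₁, ha₂⟩ := hli _ _ h
  exact ⟨ha₁, ha₂, hb₁, hb₂⟩

lemma IsComplexAreaForm.ne_zero_of_isComplexBasis {J : V →L[ℝ] V} {s : V →L[ℝ] V →L[ℝ] ℂ}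
    (hs : IsComplexAreaForm J s) (hne : ∃ a b, s a b ≠ 0) {u v : V}
    (h : IsComplexBasis J u v) : s u v ≠ 0 := by
  intro h0
  obtain ⟨a, b, hab⟩ := hne
  obtain ⟨a₁, a₂, a₃, a₄, ha⟩ := h a
  obtain ⟨b₁, b₂, b₃, b₄, hb⟩ := h b
  apply hab
  rw [ha, hs.apply_left, hs.swap u b, hs.swap v b, hb, hs.apply_left, hs.apply_left,
    hs.alternating, hs.alternating, hs.swap v u, h0]
  ring

/-- Four times the `(2, 0)`-part with respect to `J` of a complex valued bilinear form `s`. -/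
def twoZeroPart (J : V →L[ℝ] V) (s : V →L[ℝ] V →L[ℝ] ℂ) (u v : V) : ℂ :=
  s u v - Complex.I * s (J u) v - Complex.I * s u (J v) - s (J u) (J v)

lemma det_pos_of_quadratic_pos {a b c : ℝ}
    (h : ∀ x y : ℝ, (x ≠ 0 ∨ y ≠ 0) → 0 < x * x * a + 2 * (x * y) * b + y * y * c) :
    0 < a ∧ b * b < a * c := by
  have ha : 0 < a := by simpa using h 1 0 (Or.inl one_ne_zero)
  refine ⟨ha, ?_⟩
  -- At `(-b, a)` the quadratic form takes the value `a (a c - b²)`.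
  have h1 := h (-b) a (Or.inr ha.ne')
  have h2 : 0 < a * (a * c - b * b) := by linarith
  have := (pos_iff_pos_of_mul_pos h2).1 ha
  linarith

/-- The determinant of a complex symmetric `2 × 2` matrix with positive definite real part avoids
the closed negative real axis. -/
lemma re_det_pos_of_im_det_eq_zero {p₁ p₂ p₃ q₁ q₂ q₃ : ℝ} (hp : p₂ * p₂ < p₁ * p₃)
    (him : p₁ * q₃ + p₃ * q₁ = 2 * (p₂ * q₂)) :
    0 < p₁ * p₃ - p₂ * p₂ - (q₁ * q₃ - q₂ * q₂) := by
  have hp₃ : 0 < p₁ * p₃ := lt_of_le_of_lt (mul_self_nonneg _) hp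
  -- The determinant of `P + iQ` has real part `det P - det Q`. When its imaginary part vanishes,
  -- this identity forces `det Q ≤ 0`, while `det P > 0`.
  have key : p₁ * p₃ * (q₁ * q₃ - q₂ * q₂) =
      -(p₁ * q₃ - p₂ * q₂) ^ 2 - (p₁ * p₃ - p₂ * p₂) * (q₂ * q₂) := by
    have : p₃ * q₁ = 2 * (p₂ * q₂) - p₁ * q₃ := by linarith
    linear_combination (p₁ * q₃) * this
  have h1 : 0 ≤ (p₁ * p₃ - p₂ * p₂) * (q₂ * q₂) :=
    mul_nonneg (by linarith) (mul_self_nonneg _)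
  have h2 : p₁ * p₃ * (q₁ * q₃ - q₂ * q₂) ≤ 0 := by
    rw [key]
    nlinarith [sq_nonneg (p₁ * q₃ - p₂ * q₂)]
  have h3 : q₁ * q₃ - q₂ * q₂ ≤ 0 := by
    by_contra h
    push Not at h
    have := mul_pos hp₃ h
    linarith
  linarith

/-- On a Lagrangian plane, the ratio of the `(2, 0)`-part with respect to `J₀` of a `J₁`-complex
area form to that form avoids the closed negative real axis. -/
lemma twoZeroPart_div_mem_slitPlane (hV : Module.finrank ℝ V = 4) (hw : ∀ v, w v v = 0)
    {J₀ J₁ : V →L[ℝ] V} (hJ₀ : CompatibleAt w J₀) (hJ₁ : CompatibleAt w J₁)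
    {s : V →L[ℝ] V →L[ℝ] ℂ} (hs : IsComplexAreaForm J₁ s) {u v : V}
    (hli : LinearIndependent ℝ ![u, v]) (huv : w u v = 0) (hsuv : s u v ≠ 0) :
    twoZeroPart J₀ s u v / s u v ∈ Complex.slitPlane := by
  have hbasis := hJ₁.isComplexBasis hV hw hli huv
  obtain ⟨a₁₁, a₁₂, b₁₁, b₁₂, hu⟩ := hbasis (J₀ u)
  obtain ⟨a₂₁, a₂₂, b₂₁, b₂₂, hv⟩ := hbasis (J₀ v)
  rw [LinearIndependent.pair_iff] at hli
  have hvu : w v u = 0 := by rw [swap_of_alternating hw, huv, neg_zero]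
  -- In the complex basis `u, v` the restriction of `J₀` to the plane has the complex matrix `A +
  -- iB`, with `A = (aᵢⱼ)` and `B = (bᵢⱼ)`. The quotient is `det (1 - i(A + iB)) = det (1 + B -
  -- iA)`.
  have hq : twoZeroPart J₀ s u v / s u v =
      (1 - Complex.I * (a₁₁ + Complex.I * b₁₁)) * (1 - Complex.I * (a₂₂ + Complex.I * b₂₂))
        + (a₁₂ + Complex.I * b₁₂) * (a₂₁ + Complex.I * b₂₁) := by
    rw [div_eq_iff hsuv, twoZeroPart]
    have e1 : s (J₀ u) v = (a₁₁ + Complex.I * b₁₁) * s u v := by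
      rw [hu, hs.apply_left, hs.alternating]
      ring
    have e2 : s u (J₀ v) = (a₂₂ + Complex.I * b₂₂) * s u v := by
      rw [hv, hs.swap, hs.apply_left, hs.alternating, hs.swap v u]
      ring
    have e3 : s (J₀ u) (J₀ v) = ((a₁₁ + Complex.I * b₁₁) * (a₂₂ + Complex.I * b₂₂)
        - (a₁₂ + Complex.I * b₁₂) * (a₂₁ + Complex.I * b₂₁)) * s u v := by
      rw [hu, hs.apply_left, e2, hv, hs.swap v, hs.apply_left, hs.alternating]
      ring
    rw [e1, e2, e3]
    linear_combination (-(a₁₁ + Complex.I * b₁₁) * (a₂₂ + Complex.I * b₂₂) * s u v)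
      * Complex.I_sq
  set p := w u (J₁ u) with hp
  set t := w u (J₁ v) with ht
  set r := w v (J₁ v) with hr
  have ht' : w v (J₁ u) = t := hJ₁.symm hw v u
  set g₁ := w u (J₀ u) with hg₁
  set g₂ := w u (J₀ v) with hg₂
  set g₃ := w v (J₀ v) with hg₃
  have hg₂' : w v (J₀ u) = g₂ := hJ₀.symm hw v u
  have expand : ∀ y z a₁ a₂ b₁ b₂ : ℝ,
      w (y • u + z • v) (a₁ • u + a₂ • v + b₁ • J₁ u + b₂ • J₁ v) =
        y * (b₁ * p + b₂ * t) + z * (b₁ * t + b₂ * r) := by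
    intro y z a₁ a₂ b₁ b₂
    simp only [map_add, map_smul, add_apply, smul_apply,
      smul_eq_mul, hw, huv, hvu, ht', ← hp, ← ht, ← hr]
    ring
  -- Let `G` and `P` be the Gram matrices on the plane of the metrics `w(·, J₀ ·)` and `w(·, J₁ ·)`.
  -- These equations say `G = B P = P Bᵀ`.
  have e₁ : g₁ = b₁₁ * p + b₁₂ * t := by simpa [← hu] using expand 1 0 a₁₁ a₁₂ b₁₁ b₁₂
  have e₂ : g₂ = b₂₁ * p + b₂₂ * t := by simpa [← hv] using expand 1 0 a₂₁ a₂₂ b₂₁ b₂₂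
  have e₂' : g₂ = b₁₁ * t + b₁₂ * r := by
    simpa [← hu, hg₂'] using expand 0 1 a₁₁ a₁₂ b₁₁ b₁₂
  have e₃ : g₃ = b₂₁ * t + b₂₂ * r := by simpa [← hv] using expand 0 1 a₂₁ a₂₂ b₂₁ b₂₂
  -- The matrix `A G` is symmetric: this is `w(J₀ u, J₀ v) = w(u, v) = 0` written out.
  have hcomm : a₁₁ * g₂ + a₁₂ * g₃ = a₂₁ * g₁ + a₂₂ * g₂ := by
    have h1 := hJ₀.invariant u v
    rw [huv] at h1
    have h2 : w (J₁ u) u = -p := swap_of_alternating hw _ _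
    have h3 : w (J₁ u) v = -t := by rw [swap_of_alternating hw, ht']
    have h4 : w (J₁ v) u = -t := swap_of_alternating hw _ _
    have h5 : w (J₁ v) v = -r := swap_of_alternating hw _ _
    rw [hu, hv] at h1
    simp only [map_add, map_smul, add_apply, smul_apply,
      smul_eq_mul, hw, huv, hvu, ht', ← hp, ← ht, ← hr, hJ₁.invariant, h2, h3, h4, h5] at h1
    rw [e₃, e₁]
    linear_combination h1 + a₁₁ * e₂ - a₂₂ * e₂'
  have quad : ∀ {J : V →L[ℝ] V}, CompatibleAt w J → ∀ x y : ℝ, (x ≠ 0 ∨ y ≠ 0) →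
      0 < x * x * w u (J u) + 2 * (x * y) * w u (J v) + y * y * w v (J v) := by
    intro J hJ x y hxy
    have hne : x • u + y • v ≠ 0 := by
      intro h
      obtain ⟨h1, h2⟩ := hli _ _ h
      tauto
    have := hJ.positive _ hne
    simp only [map_add, map_smul, add_apply, smul_apply,
      smul_eq_mul, hJ.symm hw v u] at this
    linarith
  have quad₁ : ∀ x y : ℝ, 0 ≤ x * x * p + 2 * (x * y) * t + y * y * r := by
    intro x y
    by_cases hxy : x ≠ 0 ∨ y ≠ 0
    · exact (quad hJ₁ x y hxy).le
    · push Not at hxy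
      simp [hxy.1, hxy.2]
  obtain ⟨hg₁pos, hgdet⟩ := det_pos_of_quadratic_pos (quad hJ₀)
  -- Since `B G = B P Bᵀ` is positive semidefinite, `G + B G` is positive definite. Thus `(1 + B -
  -- iA) G` is complex symmetric with positive definite real part, and dividing its determinant by
  -- `det G > 0` preserves the slit plane.
  obtain ⟨-, hPdet⟩ := det_pos_of_quadratic_pos
    (a := g₁ + (b₁₁ * g₁ + b₁₂ * g₂)) (b := g₂ + (b₁₁ * g₂ + b₁₂ * g₃))
    (c := g₃ + (b₂₁ * g₂ + b₂₂ * g₃)) (by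
      intro x y hxy
      have h1 := quad hJ₀ x y hxy
      have h2 := quad₁ (x * b₁₁ + y * b₂₁) (x * b₁₂ + y * b₂₂)
      have h3 : x * x * (b₁₁ * g₁ + b₁₂ * g₂) + 2 * (x * y) * (b₁₁ * g₂ + b₁₂ * g₃)
          + y * y * (b₂₁ * g₂ + b₂₂ * g₃) =
          (x * b₁₁ + y * b₂₁) * (x * b₁₁ + y * b₂₁) * p
          + 2 * ((x * b₁₁ + y * b₂₁) * (x * b₁₂ + y * b₂₂)) * t
          + (x * b₁₂ + y * b₂₂) * (x * b₁₂ + y * b₂₂) * r := by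
        rw [e₃]
        linear_combination (x * x * b₁₁) * e₁ + (x * x * b₁₂) * e₂' +
          (2 * x * y * b₁₁ + y * y * b₂₁) * e₂
      linarith)
  have hBsymm : b₁₁ * g₂ + b₁₂ * g₃ = b₂₁ * g₁ + b₂₂ * g₂ := by
    rw [e₁, e₃]
    linear_combination b₁₁ * e₂ - b₂₂ * e₂'
  have hdet : 0 < g₁ * g₃ - g₂ * g₂ := by linarith
  rw [hq, Complex.mem_slitPlane_iff]
  by_contra hcon
  push Not at hcon
  obtain ⟨hre, him⟩ := hcon
  simp only [Complex.add_re, Complex.add_im, Complex.mul_re, Complex.mul_im, Complex.sub_re,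
    Complex.sub_im, Complex.one_re, Complex.one_im, Complex.I_re, Complex.I_im,
    Complex.ofReal_re, Complex.ofReal_im] at hre him
  have him' : a₁₁ * (1 + b₂₂) + a₂₂ * (1 + b₁₁) - a₁₂ * b₂₁ - a₂₁ * b₁₂ = 0 := by linarith
  have key := re_det_pos_of_im_det_eq_zero (q₁ := a₁₁ * g₁ + a₁₂ * g₂)
    (q₂ := a₁₁ * g₂ + a₁₂ * g₃) (q₃ := a₂₁ * g₂ + a₂₂ * g₃) hPdet (by
      linear_combination (g₁ * g₃ - g₂ * g₂) * him' - (g₂ + (b₁₁ * g₂ + b₁₂ * g₃)) * hcomm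
        - (a₁₁ * g₂ + a₁₂ * g₃) * hBsymm)
  have hneg : (g₁ * g₃ - g₂ * g₂) *
      ((1 + b₁₁) * (1 + b₂₂) - b₁₂ * b₂₁ - (a₁₁ * a₂₂ - a₁₂ * a₂₁)) ≤ 0 :=
    mul_nonpos_of_nonneg_of_nonpos hdet.le (by linarith)
  have heq : (g₁ + (b₁₁ * g₁ + b₁₂ * g₂)) * (g₃ + (b₂₁ * g₂ + b₂₂ * g₃)) -
      (g₂ + (b₁₁ * g₂ + b₁₂ * g₃)) * (g₂ + (b₁₁ * g₂ + b₁₂ * g₃)) -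
      ((a₁₁ * g₁ + a₁₂ * g₂) * (a₂₁ * g₂ + a₂₂ * g₃) -
        (a₁₁ * g₂ + a₁₂ * g₃) * (a₁₁ * g₂ + a₁₂ * g₃)) =
      (g₁ * g₃ - g₂ * g₂) * ((1 + b₁₁) * (1 + b₂₂) - b₁₂ * b₂₁ - (a₁₁ * a₂₂ - a₁₂ * a₂₁)) := by
    linear_combination -(g₂ + (b₁₁ * g₂ + b₁₂ * g₃)) * hBsymm + (a₁₁ * g₂ + a₁₂ * g₃) * hcomm
  rw [heq] at key
  exact key.not_ge hneg

/-- A `4`-dimensional symplectic vector space contains a Lagrangian plane. -/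
lemma exists_lagrangian_pair (hV : Module.finrank ℝ V = 4) (w : V →L[ℝ] V →L[ℝ] ℝ) :
    ∃ u v : V, LinearIndependent ℝ ![u, v] ∧ w u v = 0 := by
  have : FiniteDimensional ℝ V := FiniteDimensional.of_finrank_pos (by omega)
  have : Nontrivial V := Module.nontrivial_of_finrank_pos (R := ℝ) (by omega)
  obtain ⟨u, hu⟩ := exists_ne (0 : V)
  -- A hyperplane containing the kernel bound `3` cannot fit in the line through `u`, so `v` exists
  -- off that line.
  have hker : 3 ≤ Module.finrank ℝ (LinearMap.ker (w u).toLinearMap) := by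
    have h1 := LinearMap.finrank_range_add_finrank_ker (w u).toLinearMap
    have h2 := Submodule.finrank_le (LinearMap.range (w u).toLinearMap)
    rw [Module.finrank_self] at h2
    omega
  have hnot : ¬ LinearMap.ker (w u).toLinearMap ≤ Submodule.span ℝ {u} := by
    intro h
    have h1 := Submodule.finrank_mono h
    rw [finrank_span_singleton hu] at h1
    omega
  obtain ⟨v, hv, hvu⟩ := SetLike.not_le_iff_exists.1 hnot
  refine ⟨u, v, ?_, hv⟩
  rw [LinearIndependent.pair_iff' hu]
  intro a ha
  exact hvu (Submodule.mem_span_singleton.2 ⟨a, ha⟩)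

/-- The `(2, 0)`-part of a bilinear form, as a continuous bilinear form. -/
lemma exists_isComplexAreaForm_twoZeroPart [IsTopologicalAddGroup V] [ContinuousSMul ℝ V]
    {J₀ J₁ : V →L[ℝ] V} (hJ₀ : ∀ v, J₀ (J₀ v) = -v)
    {s : V →L[ℝ] V →L[ℝ] ℂ} (hs : IsComplexAreaForm J₁ s) :
    ∃ q : V →L[ℝ] V →L[ℝ] ℂ, IsComplexAreaForm J₀ q ∧ ∀ u v, q u v = twoZeroPart J₀ s u v := by
  let P : (V →L[ℝ] ℂ) →L[ℝ] (V →L[ℝ] ℂ) := ContinuousLinearMap.precomp ℂ J₀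
  let q : V →L[ℝ] V →L[ℝ] ℂ :=
    s - Complex.I • (s ∘L J₀) - Complex.I • (P ∘L s) - (P ∘L s) ∘L J₀
  have hq : ∀ u v, q u v = twoZeroPart J₀ s u v := fun u v => rfl
  refine ⟨q, ⟨fun v => ?_, fun u v => ?_⟩, hq⟩
  · rw [hq, twoZeroPart, hs.alternating, hs.alternating, hs.swap v]
    ring
  · simp only [hq, twoZeroPart, hJ₀, map_neg, neg_apply]
    linear_combination (s (J₀ u) v + s u (J₀ v)) * Complex.I_sq

end SymplecticLinearAlgebra

/-! ### Lifting circle valued functions over singular simplices -/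

section Lifting

/-- Every continuous map from a standard simplex to the circle lifts to the real line. -/
lemma exists_lift_stdSimplex {n : ℕ} (g : C(stdSimplex ℝ (Fin (n + 1)), Circle)) :
    ∃ f : C(stdSimplex ℝ (Fin (n + 1)), ℝ), ∀ p, Circle.exp (2 * Real.pi * f p) = g p := by
  let v : stdSimplex ℝ (Fin (n + 1)) := stdSimplex.vertex 0
  -- The straight-line contraction: constant at the vertex `v` at time `0`, the identity at time
  -- `1`. A lift of `g ∘ c` that starts at a constant therefore ends at a lift of `g`.
  let c : C(unitInterval × stdSimplex ℝ (Fin (n + 1)), stdSimplex ℝ (Fin (n + 1))) :=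
    ⟨fun q => ⟨(1 - (q.1 : ℝ)) • v.1 + (q.1 : ℝ) • q.2.1,
      convex_stdSimplex ℝ _ v.2 q.2.2 (by linarith [q.1.2.2]) q.1.2.1 (by ring)⟩, by
      fun_prop⟩
  obtain ⟨e, he⟩ : ∃ e : ℝ, Circle.exp e = g v := Circle.exp_surjective (g v)
  have h0 : ∀ a, (g.comp c) (0, a) = Circle.exp ((ContinuousMap.const _ e) a) := by
    intro a
    rw [ContinuousMap.const_apply, he, ContinuousMap.comp_apply]
    congr 1
    apply Subtype.ext
    simp [c]
  let F := Circle.isCoveringMap_exp.liftHomotopy (g.comp c) (ContinuousMap.const _ e) h0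
  refine ⟨⟨fun p => (2 * Real.pi)⁻¹ * F (1, p), by fun_prop⟩, fun p => ?_⟩
  have h1 := congrFun (Circle.isCoveringMap_exp.liftHomotopy_lifts (g.comp c)
    (ContinuousMap.const _ e) h0) (1, p)
  refine (congrArg Circle.exp (mul_inv_cancel_left₀ Real.two_pi_pos.ne' (F (1, p)))).trans ?_
  refine h1.trans ?_
  rw [ContinuousMap.comp_apply]
  congr 1
  apply Subtype.ext
  simp [c]

/-- Two lifts of the same circle valued map on a connected space differ by a constant. -/
lemma lift_sub_eq {A : Type*} [TopologicalSpace A] [PreconnectedSpace A] {f f' : A → ℝ}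
    (hf : Continuous f) (hf' : Continuous f')
    (h : ∀ p, Circle.exp (2 * Real.pi * f p) = Circle.exp (2 * Real.pi * f' p)) (p q : A) :
    f p - f q = f' p - f' q := by
  have hint : ∀ p, ∃ m : ℤ, (m : ℝ) = f p - f' p := by
    intro p
    obtain ⟨m, hm⟩ := Circle.exp_eq_exp.1 (h p)
    refine ⟨m, ?_⟩
    have h2 : 2 * Real.pi * (f p) = 2 * Real.pi * (f' p + m) := by rw [hm]; ring
    have := mul_left_cancel₀ Real.two_pi_pos.ne' h2
    linarith
  choose m hm using hint
  have hmc : Continuous m := by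
    rw [Int.isClosedEmbedding_coe_real.isEmbedding.continuous_iff]
    exact (hf.sub hf').congr fun p => (hm p).symm
  have := PreconnectedSpace.constant (by infer_instance) hmc (x := p) (y := q)
  have h1 := hm p
  have h2 := hm q
  rw [this] at h1
  linarith

end Lifting

/-! ### Singular chains and cochains in degree one -/

section SingularCochains

open scoped Simplicial

variable {X Y : Type u} [TopologicalSpace X] [TopologicalSpace Y]

/-- The singular simplex given by a continuous map from the standard simplex. -/
abbrev singSimplex (n : ℕ) (σ : C(stdSimplex ℝ (Fin (n + 1)), X)) : (Sing X) _⦋n⦌ :=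
  ((TopCat.toSSetObjEquiv (TopCat.of X) (.op ⦋n⦌)).symm σ)

lemma singSimplex_surjective (n : ℕ) (τ : (Sing X) _⦋n⦌) : ∃ σ, singSimplex n σ = τ :=
  (TopCat.toSSetObjEquiv (TopCat.of X) (.op ⦋n⦌)).symm.surjective τ

/-- The vertices of `X` as singular `0`-simplices. -/
abbrev singPoint (x : X) : (Sing X) _⦋0⦌ := singSimplex 0 (ContinuousMap.const _ x)

lemma delta_singSimplex {n : ℕ} (σ : C(stdSimplex ℝ (Fin (n + 2)), X)) (i : Fin (n + 2)) :
    (Sing X).δ i (singSimplex (n + 1) σ) =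
      singSimplex n (σ.comp ⟨stdSimplex.map i.succAbove, stdSimplex.continuous_map _⟩) := rfl

lemma singSimplex_zero (σ : C(stdSimplex ℝ (Fin 1), X)) :
    singSimplex 0 σ = singPoint (σ (stdSimplex.vertex 0)) := by
  congr 1
  ext p
  rw [ContinuousMap.const_apply, Subsingleton.elim p (stdSimplex.vertex 0)]

lemma delta_zero_edge (σ : C(Edge, X)) :
    (Sing X).δ 0 (singSimplex 1 σ) = singPoint (σ (stdSimplex.vertex 1)) := by
  rw [delta_singSimplex, singSimplex_zero]
  exact congrArg (fun p => singPoint (σ p)) (stdSimplex.map_vertex _ _)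

lemma delta_one_edge (σ : C(Edge, X)) :
    (Sing X).δ 1 (singSimplex 1 σ) = singPoint (σ (stdSimplex.vertex 0)) := by
  rw [delta_singSimplex, singSimplex_zero]
  exact congrArg (fun p => singPoint (σ p)) (stdSimplex.map_vertex _ _)

/-- Homomorphisms on singular chains are determined by their values on simplices. -/
lemma chains_hom_ext {n : ℕ} {D D' : (SingChains X).X n →ₗ[ℤ] ℝ}
    (h : ∀ σ, D (((Sing X).ιChainComplex (R := IntCoeff) (singSimplex n σ)).hom (ULift.up 1)) =
      D' (((Sing X).ιChainComplex (R := IntCoeff) (singSimplex n σ)).hom (ULift.up 1))) :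
    D = D' := by
  -- Lifting `ℝ` to the universe `u` turns cochains into morphisms of the module category, to which
  -- extensionality on simplices applies.
  let e : ℝ ≃ₗ[ℤ] ULift.{u} ℝ := ULift.moduleEquiv.symm
  let f : (SingChains X).X n ⟶ ModuleCat.of ℤ (ULift.{u} ℝ) := ModuleCat.ofHom (e.toLinearMap ∘ₗ D)
  let f' : (SingChains X).X n ⟶ ModuleCat.of ℤ (ULift.{u} ℝ) :=
    ModuleCat.ofHom (e.toLinearMap ∘ₗ D')
  have hff' : f = f' := by
    apply SSet.chainComplex_hom_ext
    intro x
    obtain ⟨σ, rfl⟩ := singSimplex_surjective n x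
    apply ModuleCat.hom_ext
    apply LinearMap.ext
    intro m
    have hm : m = m.down • (ULift.up 1 : ULift.{u} ℤ) := by
      ext
      simp
    rw [hm, map_zsmul, map_zsmul]
    exact congrArg (m.down • ·) (congrArg e (h σ))
  ext z
  exact e.injective (congrArg (fun k => k.hom z) hff')

/-- A real function on points extends to singular `0`-chains. -/
lemma exists_zero_cochain (G : X → ℝ) : ∃ E : (SingChains X).X 0 →ₗ[ℤ] ℝ, ∀ x,
    E (((Sing X).ιChainComplex (R := IntCoeff) (singPoint x)).hom (ULift.up 1)) = G x := by
  let e : ULift.{u} ℝ ≃ₗ[ℤ] ℝ := ULift.moduleEquiv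
  let c : Limits.Cofan (fun _ : (Sing X) _⦋0⦌ => (IntCoeff : ModuleCat.{u} ℤ)) :=
    Limits.Cofan.mk (ModuleCat.of ℤ (ULift.{u} ℝ)) fun τ => ModuleCat.ofHom
      (((LinearMap.toSpanSingleton ℤ (ULift.{u} ℝ) (ULift.up (G (TopCat.toSSetObj₀Equiv τ)))).comp
        (ULift.moduleEquiv : ULift.{u} ℤ ≃ₗ[ℤ] ℤ).toLinearMap))
  let d := ((Sing X).isColimitChainComplexXCofan IntCoeff 0).desc c
  refine ⟨e.toLinearMap ∘ₗ d.hom, fun x => ?_⟩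
  have h := ((Sing X).isColimitChainComplexXCofan IntCoeff 0).fac c ⟨singPoint x⟩
  have h1 := congrArg (fun k => e (k.hom (ULift.up 1))) h
  refine h1.trans ?_
  simp [c, e]
  rfl

/-- A `1`-cochain that is the difference of a function at the end points of edges vanishes on
cycles. -/
lemma eq_zero_on_cycles {D : (SingChains X).X 1 →ₗ[ℤ] ℝ} (G : X → ℝ)
    (h : ∀ σ : C(Edge, X),
      D (edgeChain σ) = G (σ (stdSimplex.vertex 1)) - G (σ (stdSimplex.vertex 0)))
    (z : (SingChains X).cycles 1) : D (((SingChains X).iCycles 1).hom z) = 0 := by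
  obtain ⟨E, hE⟩ := exists_zero_cochain G
  -- The cochain is the coboundary of the extension `E` of `G`.
  have hD : D = E ∘ₗ ((SingChains X).d 1 0).hom := by
    apply chains_hom_ext
    intro σ
    have h1 := congrArg (fun k => E (k.hom (ULift.up 1)))
      ((Sing X).ιChainComplex_d (R := IntCoeff) (singSimplex 1 σ))
    refine (h σ).trans (Eq.trans ?_ h1.symm)
    rw [Fin.sum_univ_two, delta_zero_edge, delta_one_edge]
    simp [hE, sub_eq_add_neg]
  have hz := congrArg (fun k => k.hom z) ((SingChains X).iCycles_d 1 0)
  rw [hD]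
  exact (congrArg E hz).trans (map_zero E)

/-- A cohomology class is determined by a representing cochain on cycles. -/
lemma IsRepresentedBy.ext {a a' : H1 X →ₗ[ℤ] ℝ} {D D' : (SingChains X).X 1 →ₗ[ℤ] ℝ}
    (h : IsRepresentedBy a D) (h' : IsRepresentedBy a' D')
    (hD : ∀ z : (SingChains X).cycles 1,
      D (((SingChains X).iCycles 1).hom z) = D' (((SingChains X).iCycles 1).hom z)) : a = a' := by
  ext η
  obtain ⟨z, rfl⟩ := (ModuleCat.epi_iff_surjective ((SingChains X).homologyπ 1)).1 inferInstance η
  exact ((h z).trans (hD z)).trans (h' z).symm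

/-- The map on singular `1`-chains induced by a continuous map. -/
def chainMap (f : C(X, Y)) : (SingChains X).X 1 →ₗ[ℤ] (SingChains Y).X 1 :=
  ((SSet.chainComplexMap (TopCat.toSSet.map (TopCat.ofHom f)) IntCoeff).f 1).hom

lemma chainMap_edgeChain (f : C(X, Y)) (σ : C(Edge, X)) :
    chainMap f (edgeChain σ) = edgeChain (f.comp σ) :=
  congrArg (fun k => k.hom (ULift.up 1)) (SSet.ι_chainComplexMap_f _ _
    (TopCat.toSSet.map (TopCat.ofHom f)) IntCoeff (singSimplex 1 σ))

lemma IsRepresentedBy.comp (f : C(X, Y)) {a : H1 Y →ₗ[ℤ] ℝ} {D : (SingChains Y).X 1 →ₗ[ℤ] ℝ}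
    (h : IsRepresentedBy a D) : IsRepresentedBy (a ∘ₗ H1map f) (D ∘ₗ chainMap f) := by
  intro z
  let φ := SSet.chainComplexMap (TopCat.toSSet.map (TopCat.ofHom f)) IntCoeff
  have h1 := congrArg (fun k => k.hom z) (HomologicalComplex.homologyπ_naturality φ 1)
  have h2 := congrArg (fun k => k.hom z) (HomologicalComplex.cyclesMap_i φ 1)
  exact (congrArg a h1).trans ((h _).trans (congrArg D h2))

lemma H1map_comp {Z : Type u} [TopologicalSpace Z] (g : C(Y, Z)) (f : C(X, Y)) :
    H1map (g.comp f) = H1map g ∘ₗ H1map f :=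
  congrArg (fun k => k.hom) (SSet.homologyMap_comp _ _ _ (TopCat.toSSet.map (TopCat.ofHom f))
    (TopCat.toSSet.map (TopCat.ofHom g)) IntCoeff 1)

lemma H1map_id : H1map (ContinuousMap.id X) = LinearMap.id :=
  congrArg (fun k => k.hom) (SSet.homologyMap_id (Sing X) IntCoeff 1)

/-- The isomorphism on `H₁` induced by a homeomorphism. -/
def H1equiv (f : X ≃ₜ Y) : H1 X ≃ₗ[ℤ] H1 Y :=
  LinearEquiv.ofLinearMap (H1map f) (H1map f.symm)
    (by rw [← H1map_comp, ← H1map_id]; congr 1; ext y; simp)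
    (by rw [← H1map_comp, ← H1map_id]; congr 1; ext x; simp)

/-- If `H¹(X; ℝ) = 0`, the phase variation of a circle valued map on `X` is a coboundary. -/
lemma RealH1Vanishes.exists_primitive (hX : RealH1Vanishes X) (g : C(X, Circle)) :
    ∃ F : X → ℝ, ∀ σ : C(Edge, X), ∃ f : C(Edge, ℝ),
      (∀ p, Circle.exp (2 * Real.pi * f p) = g (σ p)) ∧
      f (stdSimplex.vertex 1) - f (stdSimplex.vertex 0) =
        F (σ (stdSimplex.vertex 1)) - F (σ (stdSimplex.vertex 0)) := by
  have hlift : ∀ σ : C(Edge, X), ∃ f : C(Edge, ℝ),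
      ∀ p, Circle.exp (2 * Real.pi * f p) = g (σ p) := fun σ => exists_lift_stdSimplex (g.comp σ)
  choose f hf using hlift
  let ev := TopCat.toSSetObjEquiv (TopCat.of X) (.op ⦋1⦌)
  have hev : ∀ σ, ev (singSimplex 1 σ) = σ := fun σ => Equiv.apply_symm_apply _ σ
  obtain ⟨F, hF⟩ := hX (fun σ => f (ev σ) (stdSimplex.vertex 1) - f (ev σ) (stdSimplex.vertex 0))
    (by
      intro τ
      obtain ⟨T, rfl⟩ := singSimplex_surjective 2 τ
      -- Cocycle condition: one lift `k` over the whole triangle differs by constants from the lifts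
      -- chosen on its edges, so the three variations are differences of vertex values of `k` and
      -- telescope.
      obtain ⟨k, hk⟩ := exists_lift_stdSimplex (g.comp T)
      have key : ∀ i : Fin 3, f (ev ((Sing X).δ i (singSimplex 2 T))) (stdSimplex.vertex 1) -
          f (ev ((Sing X).δ i (singSimplex 2 T))) (stdSimplex.vertex 0) =
          k (stdSimplex.vertex (i.succAbove 1)) - k (stdSimplex.vertex (i.succAbove 0)) := by
        intro i
        rw [delta_singSimplex, hev, ← stdSimplex.map_vertex (S := ℝ) i.succAbove 1,
          ← stdSimplex.map_vertex (S := ℝ) i.succAbove 0]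
        refine lift_sub_eq (f' := fun p => k (stdSimplex.map i.succAbove p)) (f _).continuous
          (k.continuous.comp (stdSimplex.continuous_map _)) (fun p => ?_) _ _
        rw [hf, hk]
        rfl
      simp only [key]
      have e1 : (0 : Fin 3).succAbove 1 = 2 := rfl
      have e2 : (0 : Fin 3).succAbove 0 = 1 := rfl
      have e3 : (1 : Fin 3).succAbove 1 = 2 := rfl
      have e4 : (1 : Fin 3).succAbove 0 = 0 := rfl
      have e5 : (2 : Fin 3).succAbove 1 = 1 := rfl
      have e6 : (2 : Fin 3).succAbove 0 = 0 := rfl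
      rw [e1, e2, e3, e4, e5, e6]
      ring)
  refine ⟨fun x => F (singPoint x), fun σ => ⟨f σ, hf σ, ?_⟩⟩
  have h := hF (singSimplex 1 σ)
  rwa [delta_zero_edge, delta_one_edge, hev] at h

end SingularCochains

/-! ### Continuity of forms on the tangent bundle -/

section TangentContinuity

variable {M : Type u} [TopologicalSpace M] [ChartedSpace E4 M] [IsManifold (𝓡 4) ∞ M]

omit [IsManifold (𝓡 4) ∞ M] in
lemma finrank_tangentSpace (x : M) : Module.finrank ℝ (TangentSpace (𝓡 4) x) = 4 := by
  change Module.finrank ℝ E4 = 4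
  simp

variable (M) in
/-- The total space of the Whitney sum of two copies of the tangent bundle. -/
abbrev DoubleTangentBundle : Type u :=
  Bundle.TotalSpace (E4 × E4)
    ((TangentSpace (𝓡 4) : M → Type) ×ᵇ (TangentSpace (𝓡 4) : M → Type))

/-- A continuous field of `w`-compatible complex structures `J`, together with a continuous nowhere
vanishing field of `J`-complex area forms. -/
structure IsContinuousAreaForm (w : BilinForm M)
    (J : ∀ x : M, TangentSpace (𝓡 4) x →L[ℝ] TangentSpace (𝓡 4) x)
    (s : ComplexBilinForm M) : Prop where
  compatible : ∀ x, CompatibleAt (w x) (J x)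
  areaForm : ∀ x, IsComplexAreaForm (J x) (s x)
  nonvanishing : ∀ x, ∃ u v, s x u v ≠ 0
  continuous_J : Continuous fun a : TangentBundle (𝓡 4) M =>
    (⟨a.1, J a.1 a.2⟩ : TangentBundle (𝓡 4) M)
  continuous_form : Continuous fun q : DoubleTangentBundle M => s q.1 q.2.1 q.2.2

/-- Passes from sections of Hom bundles to continuity of evaluation on tangent vectors; in that
form, pulling back by a diffeomorphism amounts to composing with tangent maps. -/
lemma IsContinuousAreaForm.of_isCompatible {w : BilinForm M}
    {J : ∀ x : M, TangentSpace (𝓡 4) x →L[ℝ] TangentSpace (𝓡 4) x} {s : ComplexBilinForm M}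
    (hJ : IsCompatible w J) (hs : IsNonvanishingSection J Set.univ s) :
    IsContinuousAreaForm w J s where
  compatible x := ⟨hJ.sq x, hJ.invariant x, hJ.positive x⟩
  areaForm x := ⟨hs.alternating x trivial, hs.complexLinear x trivial⟩
  nonvanishing x := hs.nonvanishing x trivial
  continuous_J := by
    have hproj : Continuous fun a : TangentBundle (𝓡 4) M => a.1 :=
      FiberBundle.continuous_proj E4 (TangentSpace (𝓡 4) : M → Type)
    exact Continuous.clm_bundle_apply (F₁ := E4) (F₂ := E4)
      (E₁ := fun x : M => TangentSpace (𝓡 4) x) (E₂ := fun x : M => TangentSpace (𝓡 4) x)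
      (b := fun a : TangentBundle (𝓡 4) M => a.1) (ϕ := fun a => J a.1) (v := fun a => a.2)
      (hJ.smooth.continuous.comp hproj) continuous_id
  continuous_form := by
    have hproj : Continuous fun q : DoubleTangentBundle M => q.1 :=
      FiberBundle.continuous_proj (E4 × E4) _
    have hdiag := (FiberBundle.Prod.isInducing_diag E4 (TangentSpace (𝓡 4) : M → Type) E4
      (TangentSpace (𝓡 4) : M → Type)).continuous
    have h1 := Continuous.clm_bundle_apply₂ (F₁ := E4) (F₂ := E4) (F₃ := ℂ)
      (E₁ := fun x : M => TangentSpace (𝓡 4) x) (E₂ := fun x : M => TangentSpace (𝓡 4) x)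
      (E₃ := Bundle.Trivial M ℂ)
      (b := fun q : DoubleTangentBundle M => q.1) (ψ := fun q => s q.1) (v := fun q => q.2.1)
      (w := fun q => q.2.2)
      ((continuousOn_univ.1 hs.continuousOn).comp hproj) (continuous_fst.comp hdiag)
      (continuous_snd.comp hdiag)
    exact (Bundle.Trivial.homeomorphProd M ℂ).continuous.snd.comp h1

section Evaluation

variable {w : BilinForm M} {J : ∀ x : M, TangentSpace (𝓡 4) x →L[ℝ] TangentSpace (𝓡 4) x}
  {s : ComplexBilinForm M} {T : Type*} [TopologicalSpace T] {f : T → M}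
  {a b : ∀ t, TangentSpace (𝓡 4) (f t)} {t₀ : T}

lemma IsContinuousAreaForm.continuousAt_apply (h : IsContinuousAreaForm w J s)
    (ha : ContinuousAt (fun t => (⟨f t, a t⟩ : TangentBundle (𝓡 4) M)) t₀)
    (hb : ContinuousAt (fun t => (⟨f t, b t⟩ : TangentBundle (𝓡 4) M)) t₀) :
    ContinuousAt (fun t => s (f t) (a t) (b t)) t₀ := by
  have hq : ContinuousAt (fun t => (⟨f t, (a t, b t)⟩ : DoubleTangentBundle M)) t₀ :=
    (FiberBundle.Prod.isInducing_diag E4 (TangentSpace (𝓡 4) : M → Type) E4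
      (TangentSpace (𝓡 4) : M → Type)).continuousAt_iff.2 (ha.prodMk hb)
  exact h.continuous_form.continuousAt.comp hq

lemma IsContinuousAreaForm.continuousAt_J (h : IsContinuousAreaForm w J s)
    (ha : ContinuousAt (fun t => (⟨f t, a t⟩ : TangentBundle (𝓡 4) M)) t₀) :
    ContinuousAt (fun t => (⟨f t, J (f t) (a t)⟩ : TangentBundle (𝓡 4) M)) t₀ :=
  h.continuous_J.continuousAt.comp ha

lemma IsContinuousAreaForm.continuousAt_twoZeroPart {J' s'} (h : IsContinuousAreaForm w J s)
    (h' : IsContinuousAreaForm w J' s')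
    (ha : ContinuousAt (fun t => (⟨f t, a t⟩ : TangentBundle (𝓡 4) M)) t₀)
    (hb : ContinuousAt (fun t => (⟨f t, b t⟩ : TangentBundle (𝓡 4) M)) t₀) :
    ContinuousAt (fun t => twoZeroPart (J (f t)) (s' (f t)) (a t) (b t)) t₀ := by
  unfold twoZeroPart
  exact (((h'.continuousAt_apply ha hb).sub (continuousAt_const.mul
    (h'.continuousAt_apply (h.continuousAt_J ha) hb))).sub (continuousAt_const.mul
    (h'.continuousAt_apply ha (h.continuousAt_J hb)))).sub
    (h'.continuousAt_apply (h.continuousAt_J ha) (h.continuousAt_J hb))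

end Evaluation

/-- Every tangent vector extends to a vector field that is continuous at its base point. -/
lemma exists_continuousAt_extension (x₀ : M) (u : TangentSpace (𝓡 4) x₀) :
    ∃ a : ∀ x : M, TangentSpace (𝓡 4) x, a x₀ = u ∧
      ContinuousAt (fun x => (⟨x, a x⟩ : TangentBundle (𝓡 4) M)) x₀ := by
  let e := trivializationAt E4 (TangentSpace (𝓡 4) : M → Type) x₀
  have hx₀ : x₀ ∈ e.baseSet := FiberBundle.mem_baseSet_trivializationAt' x₀
  -- Constant coordinates in the trivialization around `x₀`.
  refine ⟨fun x => e.symm x (e ⟨x₀, u⟩).2, ?_, ?_⟩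
  · exact e.symm_apply_apply_mk hx₀ u
  · have h1 : ContinuousAt (fun x => (x, (e ⟨x₀, u⟩).2)) x₀ := by fun_prop
    have h2 : (x₀, (e ⟨x₀, u⟩).2) ∈ e.target := e.mem_target.2 hx₀
    have h3 : ContinuousAt (fun x => e.toOpenPartialHomeomorph.symm (x, (e ⟨x₀, u⟩).2)) x₀ :=
      ContinuousAt.comp (f := fun x => (x, (e ⟨x₀, u⟩).2))
        (e.toOpenPartialHomeomorph.continuousAt_symm h2) h1
    refine h3.congr ?_
    filter_upwards [e.open_baseSet.mem_nhds hx₀] with x hx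
    exact (e.mk_symm hx _).symm

/-- The `(2, 0)`-part of one area form is a continuous nonvanishing multiple of another one. -/
lemma IsContinuousAreaForm.exists_ratio {w : BilinForm M} (hw : ∀ x v, w x v v = 0)
    {J₀ J₁ : ∀ x : M, TangentSpace (𝓡 4) x →L[ℝ] TangentSpace (𝓡 4) x}
    {s₀ s₁ : ComplexBilinForm M} (h₀ : IsContinuousAreaForm w J₀ s₀)
    (h₁ : IsContinuousAreaForm w J₁ s₁) :
    ∃ ρ : M → ℂ, Continuous ρ ∧ (∀ x, ρ x ≠ 0) ∧
      ∀ x u v, twoZeroPart (J₀ x) (s₁ x) u v = ρ x * s₀ x u v := by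
  choose u v huv using h₀.nonvanishing
  let ρ : M → ℂ := fun x => twoZeroPart (J₀ x) (s₁ x) (u x) (v x) / s₀ x (u x) (v x)
  have hρ : ∀ x a b, twoZeroPart (J₀ x) (s₁ x) a b = ρ x * s₀ x a b := by
    intro x a b
    obtain ⟨q, hq, hqe⟩ := exists_isComplexAreaForm_twoZeroPart (h₀.compatible x).sq
      (h₁.areaForm x)
    have := (h₀.areaForm x).proportional (finrank_tangentSpace x) hq (huv x) a b
    rw [hqe, hqe] at this
    rw [div_mul_eq_mul_div, eq_div_iff (huv x), this]
  refine ⟨ρ, ?_, ?_, hρ⟩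
  -- The frames defining `ρ` were chosen pointwise. Near `x₀` the same `ρ` is the quotient on any
  -- frame with nonzero denominator, in particular on one continuous at `x₀`.
  · rw [continuous_iff_continuousAt]
    intro x₀
    obtain ⟨a, ha, hac⟩ := exists_continuousAt_extension x₀ (u x₀)
    obtain ⟨b, hb, hbc⟩ := exists_continuousAt_extension x₀ (v x₀)
    have hs := h₀.continuousAt_apply hac hbc
    have hq := h₀.continuousAt_twoZeroPart h₁ hac hbc
    have hne : s₀ x₀ (a x₀) (b x₀) ≠ 0 := by
      rw [ha, hb]
      exact huv x₀
    refine (hq.div hs hne).congr ?_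
    filter_upwards [hs.eventually_ne hne] with x hx
    rw [Pi.div_apply, hρ, mul_div_cancel_right₀ _ hx]
  · intro x h0
    -- A zero of `ρ` would make the quotient on a Lagrangian plane zero, and zero is not in the slit
    -- plane.
    obtain ⟨a, b, hli, hab⟩ := exists_lagrangian_pair (finrank_tangentSpace x) (w x)
    have hs₁ : s₁ x a b ≠ 0 := (h₁.areaForm x).ne_zero_of_isComplexBasis (h₁.nonvanishing x)
      ((h₁.compatible x).isComplexBasis (finrank_tangentSpace x) (hw x) hli hab)
    have := twoZeroPart_div_mem_slitPlane (finrank_tangentSpace x) (hw x) (h₀.compatible x)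
      (h₁.compatible x) (h₁.areaForm x) hli hab hs₁
    rw [hρ, h0, zero_mul, zero_div] at this
    exact Complex.zero_notMem_slitPlane this

end TangentContinuity

/-! ### The action of symplectic diffeomorphisms -/

section Diffeomorphisms

variable {M : Type u} [TopologicalSpace M] [ChartedSpace E4 M] [IsManifold (𝓡 4) ∞ M]

/-- The differential of a diffeomorphism as a linear equivalence. -/
abbrev diffEquiv (ψ : M ≃ₘ^∞⟮𝓡 4, 𝓡 4⟯ M) (x : M) :
    TangentSpace (𝓡 4) x ≃L[ℝ] TangentSpace (𝓡 4) (ψ x) :=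
  ψ.mfderivToContinuousLinearEquiv (by simp) x

omit [IsManifold (𝓡 4) ∞ M] in
lemma mfderiv_comp_diffeo (ψ φ : M ≃ₘ^∞⟮𝓡 4, 𝓡 4⟯ M) (x : M) (v : TangentSpace (𝓡 4) x) :
    mfderiv (𝓡 4) (𝓡 4) (φ.trans ψ) x v =
      mfderiv (𝓡 4) (𝓡 4) ψ (φ x) (mfderiv (𝓡 4) (𝓡 4) φ x v) :=
  congrArg (fun L => L v) (mfderiv_comp x (ψ.mdifferentiable (by simp) _)
    (φ.mdifferentiable (by simp) x))

/-- Diffeomorphisms preserving the form `w`. -/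
def PreservesForm (w : BilinForm M) (ψ : M ≃ₘ^∞⟮𝓡 4, 𝓡 4⟯ M) : Prop :=
  ∀ x u v, w (ψ x) (mfderiv (𝓡 4) (𝓡 4) ψ x u) (mfderiv (𝓡 4) (𝓡 4) ψ x v) = w x u v

omit [IsManifold (𝓡 4) ∞ M] in
lemma tangentMap_symm_tangentMap (ψ : M ≃ₘ^∞⟮𝓡 4, 𝓡 4⟯ M) (a : TangentBundle (𝓡 4) M) :
    tangentMap (𝓡 4) (𝓡 4) ψ.symm (tangentMap (𝓡 4) (𝓡 4) ψ a) = a := by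
  have h := tangentMap_comp_at (I := 𝓡 4) (I' := 𝓡 4) (I'' := 𝓡 4) (f := ψ) (g := ψ.symm) a
    (ψ.symm.mdifferentiable (by simp) _) (ψ.mdifferentiable (by simp) _)
  rw [← h]
  have : (ψ.symm ∘ ψ : M → M) = id := by
    ext x
    simp
  rw [this, tangentMap_id]
  rfl

omit [IsManifold (𝓡 4) ∞ M] in
lemma diffEquiv_symm_mk (ψ : M ≃ₘ^∞⟮𝓡 4, 𝓡 4⟯ M) (x : M) (v : TangentSpace (𝓡 4) (ψ x)) :
    (⟨x, (diffEquiv ψ x).symm v⟩ : TangentBundle (𝓡 4) M) =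
      tangentMap (𝓡 4) (𝓡 4) ψ.symm ⟨ψ x, v⟩ := by
  obtain ⟨u, rfl⟩ := (diffEquiv ψ x).surjective v
  rw [ContinuousLinearEquiv.symm_apply_apply]
  exact (tangentMap_symm_tangentMap ψ ⟨x, u⟩).symm

omit [IsManifold (𝓡 4) ∞ M] in
-- Comparing vectors in the total space avoids casts between fibres over `ψ (ψ.symm y)` and `y`.
lemma BilinForm.apply_congr (w : BilinForm M) {x y : M} {u v : TangentSpace (𝓡 4) x}
    {u' v' : TangentSpace (𝓡 4) y} (hu : (⟨x, u⟩ : TangentBundle (𝓡 4) M) = ⟨y, u'⟩)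
    (hv : (⟨x, v⟩ : TangentBundle (𝓡 4) M) = ⟨y, v'⟩) : w x u v = w y u' v' := by
  obtain rfl : x = y := congrArg (fun a : TangentBundle (𝓡 4) M => a.1) hu
  rw [Bundle.TotalSpace.mk_inj.1 hu, Bundle.TotalSpace.mk_inj.1 hv]

omit [IsManifold (𝓡 4) ∞ M] in
lemma PreservesForm.symm {w : BilinForm M} {ψ : M ≃ₘ^∞⟮𝓡 4, 𝓡 4⟯ M} (h : PreservesForm w ψ) :
    PreservesForm w ψ.symm := fun y u v =>
  (h (ψ.symm y) _ _).symm.trans (w.apply_congr (tangentMap_symm_tangentMap ψ.symm ⟨y, u⟩)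
    (tangentMap_symm_tangentMap ψ.symm ⟨y, v⟩))

omit [IsManifold (𝓡 4) ∞ M] in
lemma PreservesForm.trans {w : BilinForm M} {ψ φ : M ≃ₘ^∞⟮𝓡 4, 𝓡 4⟯ M} (hφ : PreservesForm w φ)
    (hψ : PreservesForm w ψ) : PreservesForm w (φ.trans ψ) := by
  intro x u v
  rw [mfderiv_comp_diffeo, mfderiv_comp_diffeo]
  exact (hψ _ _ _).trans (hφ _ _ _)

/-- The pull back of a field of complex structures. -/
def pullbackJ (ψ : M ≃ₘ^∞⟮𝓡 4, 𝓡 4⟯ M)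
    (J : ∀ x : M, TangentSpace (𝓡 4) x →L[ℝ] TangentSpace (𝓡 4) x) (x : M) :
    TangentSpace (𝓡 4) x →L[ℝ] TangentSpace (𝓡 4) x :=
  ((diffEquiv ψ x).symm : TangentSpace (𝓡 4) (ψ x) →L[ℝ] TangentSpace (𝓡 4) x) ∘L J (ψ x) ∘L
    (diffEquiv ψ x : TangentSpace (𝓡 4) x →L[ℝ] TangentSpace (𝓡 4) (ψ x))

/-- The pull back of a complex valued form. -/
def pullbackForm (ψ : M ≃ₘ^∞⟮𝓡 4, 𝓡 4⟯ M) (s : ComplexBilinForm M) : ComplexBilinForm M :=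
  fun x => (ContinuousLinearMap.precomp ℂ
    (diffEquiv ψ x : TangentSpace (𝓡 4) x →L[ℝ] TangentSpace (𝓡 4) (ψ x))) ∘L s (ψ x) ∘L
    (diffEquiv ψ x : TangentSpace (𝓡 4) x →L[ℝ] TangentSpace (𝓡 4) (ψ x))

omit [IsManifold (𝓡 4) ∞ M] in
lemma pullbackForm_apply (ψ : M ≃ₘ^∞⟮𝓡 4, 𝓡 4⟯ M) (s : ComplexBilinForm M) (x : M)
    (u v : TangentSpace (𝓡 4) x) :
    pullbackForm ψ s x u v = s (ψ x) (diffEquiv ψ x u) (diffEquiv ψ x v) := rfl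

omit [IsManifold (𝓡 4) ∞ M] in
lemma diffEquiv_pullbackJ (ψ : M ≃ₘ^∞⟮𝓡 4, 𝓡 4⟯ M)
    (J : ∀ x : M, TangentSpace (𝓡 4) x →L[ℝ] TangentSpace (𝓡 4) x) (x : M)
    (v : TangentSpace (𝓡 4) x) :
    diffEquiv ψ x (pullbackJ ψ J x v) = J (ψ x) (diffEquiv ψ x v) :=
  (diffEquiv ψ x).apply_symm_apply _

lemma IsContinuousAreaForm.pullback {w : BilinForm M} {ψ : M ≃ₘ^∞⟮𝓡 4, 𝓡 4⟯ M}
    (hψ : PreservesForm w ψ)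
    {J : ∀ x : M, TangentSpace (𝓡 4) x →L[ℝ] TangentSpace (𝓡 4) x} {s : ComplexBilinForm M}
    (h : IsContinuousAreaForm w J s) :
    IsContinuousAreaForm w (pullbackJ ψ J) (pullbackForm ψ s) where
  compatible x := by
    have hw : ∀ u v, w x u v = w (ψ x) (diffEquiv ψ x u) (diffEquiv ψ x v) :=
      fun u v => (hψ x u v).symm
    refine ⟨fun v => ?_, fun u v => ?_, fun v hv => ?_⟩
    · apply (diffEquiv ψ x).injective
      rw [diffEquiv_pullbackJ, diffEquiv_pullbackJ, (h.compatible _).sq, map_neg]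
    · rw [hw, hw, diffEquiv_pullbackJ, diffEquiv_pullbackJ, (h.compatible _).invariant]
    · rw [hw, diffEquiv_pullbackJ]
      exact (h.compatible _).positive _ ((diffEquiv ψ x).map_ne_zero_iff.2 hv)
  areaForm x := by
    refine ⟨fun v => ?_, fun u v => ?_⟩
    · exact (h.areaForm _).alternating _
    · rw [pullbackForm_apply, pullbackForm_apply, diffEquiv_pullbackJ]
      exact (h.areaForm _).complexLinear _ _
  nonvanishing x := by
    obtain ⟨u, v, huv⟩ := h.nonvanishing (ψ x)
    refine ⟨(diffEquiv ψ x).symm u, (diffEquiv ψ x).symm v, ?_⟩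
    rwa [pullbackForm_apply, ContinuousLinearEquiv.apply_symm_apply,
      ContinuousLinearEquiv.apply_symm_apply]
  continuous_J := by
    have h1 : Continuous (tangentMap (𝓡 4) (𝓡 4) ψ) :=
      ψ.contMDiff.continuous_tangentMap (by simp)
    have h2 : Continuous (tangentMap (𝓡 4) (𝓡 4) ψ.symm) :=
      ψ.symm.contMDiff.continuous_tangentMap (by simp)
    refine (h2.comp (h.continuous_J.comp h1)).congr fun a => ?_
    exact (diffEquiv_symm_mk ψ a.1 _).symm
  continuous_form := by
    have h1 : Continuous (tangentMap (𝓡 4) (𝓡 4) ψ) :=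
      ψ.contMDiff.continuous_tangentMap (by simp)
    have hdiag := (FiberBundle.Prod.isInducing_diag E4 (TangentSpace (𝓡 4) : M → Type) E4
      (TangentSpace (𝓡 4) : M → Type)).continuous
    rw [continuous_iff_continuousAt]
    intro q
    exact h.continuousAt_apply (f := fun q : DoubleTangentBundle M => ψ q.1)
      (a := fun q => diffEquiv ψ q.1 q.2.1) (b := fun q => diffEquiv ψ q.1 q.2.2)
      (h1.comp hdiag.fst).continuousAt (h1.comp hdiag.snd).continuousAt

omit [IsManifold (𝓡 4) ∞ M] in
lemma IsTangentTo.map {L : Set M} {x : M} {v : TangentSpace (𝓡 4) x} (h : IsTangentTo L x v)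
    (ψ : M ≃ₘ^∞⟮𝓡 4, 𝓡 4⟯ M) : IsTangentTo (ψ '' L) (ψ x) (mfderiv (𝓡 4) (𝓡 4) ψ x v) := by
  obtain ⟨c, hc, hL, ht⟩ := h
  refine ⟨ψ ∘ c, ψ.contMDiff.comp hc, fun t => ⟨c t, hL t, rfl⟩, ?_⟩
  rw [tangentMap_comp_at (I' := 𝓡 4) _ (ψ.mdifferentiable (by simp) _)
    (hc.mdifferentiable (by simp) _), ht]
  rfl

/-- The push forward of a vector field. -/
def pushforward (ψ : M ≃ₘ^∞⟮𝓡 4, 𝓡 4⟯ M) (X : ∀ x : M, TangentSpace (𝓡 4) x) (y : M) :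
    TangentSpace (𝓡 4) y :=
  mfderiv (𝓡 4) (𝓡 4) ψ (ψ.symm y) (X (ψ.symm y))

omit [IsManifold (𝓡 4) ∞ M] in
lemma pushforward_apply (ψ : M ≃ₘ^∞⟮𝓡 4, 𝓡 4⟯ M) (X : ∀ x : M, TangentSpace (𝓡 4) x) (x : M) :
    pushforward ψ X (ψ x) = mfderiv (𝓡 4) (𝓡 4) ψ x (X x) := by
  have key : ∀ z, z = x →
      ((mfderiv (𝓡 4) (𝓡 4) ψ z (X z) : E4) = (mfderiv (𝓡 4) (𝓡 4) ψ x (X x) : E4)) := by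
    rintro _ rfl
    rfl
  exact key _ (ψ.symm_apply_apply x)

omit [IsManifold (𝓡 4) ∞ M] in
/-- `Ham(M)` is invariant under conjugation by symplectic diffeomorphisms. -/
lemma conj_mem_Ham {w : BilinForm M} {ψ φ : M ≃ₘ^∞⟮𝓡 4, 𝓡 4⟯ M} (hψ : PreservesForm w ψ)
    (hφ : φ ∈ Ham w) : (ψ.symm.trans φ).trans ψ ∈ Ham w := by
  obtain ⟨hsymp, H, X, F, K, hH, hX, hK, hXK, hF0, hF, hF1⟩ := hφ
  -- The Hamiltonian `H ∘ ψ⁻¹` generates the pushed forward vector field, with flow `ψ F ψ⁻¹` and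
  -- support in `ψ(K)`.
  refine ⟨(hψ.symm.trans hsymp).trans hψ, fun t y => H t (ψ.symm y),
    fun t => pushforward ψ (X t), fun t y => ψ (F t (ψ.symm y)), ψ '' K, ?_, ?_,
    hK.image ψ.continuous, ?_, ?_, ?_, ?_⟩
  · exact hH.comp (contMDiff_fst.prodMk (ψ.symm.contMDiff.comp contMDiff_snd)).contMDiffOn
      fun q hq => ⟨hq.1, trivial⟩
  · intro t ht y v
    obtain ⟨x, rfl⟩ : ∃ x, ψ x = y := ψ.surjective y
    obtain ⟨u, rfl⟩ := (diffEquiv ψ x).surjective v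
    refine (congrArg (fun z => w (ψ x) z (diffEquiv ψ x u))
      (pushforward_apply ψ (X t) x)).trans ?_
    have hHt : ContMDiff (𝓡 4) 𝓘(ℝ, ℝ) ∞ (H t) := by
      rw [← contMDiffOn_univ]
      exact hH.comp (contMDiff_const.prodMk contMDiff_id).contMDiffOn fun q _ => ⟨ht, trivial⟩
    have h1 : mfderiv (𝓡 4) 𝓘(ℝ, ℝ) ((fun y => H t (ψ.symm y)) ∘ ψ) x u =
        mfderiv (𝓡 4) 𝓘(ℝ, ℝ) (fun y => H t (ψ.symm y)) (ψ x) (mfderiv (𝓡 4) (𝓡 4) ψ x u) :=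
      congrArg (fun L => L u) (mfderiv_comp x
        ((hHt.comp ψ.symm.contMDiff).mdifferentiable (by simp) _)
        (ψ.mdifferentiable (by simp) x))
    have h2 : (fun y => H t (ψ.symm y)) ∘ ψ = H t := by
      ext z
      simp
    rw [h2] at h1
    exact ((hψ x _ _).trans (hX t ht x u)).trans h1
  · intro t ht y hy
    have : ψ.symm y ∉ K := fun h => hy ⟨_, h, ψ.apply_symm_apply y⟩
    exact (congrArg (mfderiv (𝓡 4) (𝓡 4) ψ (ψ.symm y)) (hXK t ht _ this)).trans (map_zero _)
  · intro y
    exact (congrArg ψ (hF0 _)).trans (ψ.apply_symm_apply y)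
  · intro y t ht
    have h1 := (ψ.mdifferentiable (by simp) (F t (ψ.symm y))).hasMFDerivAt.comp_hasMFDerivWithinAt
      t (hF (ψ.symm y) t ht)
    refine h1.congr_mfderiv ?_
    have h2 := pushforward_apply ψ (X t) (F t (ψ.symm y))
    apply ContinuousLinearMap.ext
    intro (r : ℝ)
    refine (map_smul (mfderiv (𝓡 4) (𝓡 4) ψ (F t (ψ.symm y))) r _).trans ?_
    exact congrArg (fun z : E4 => r • z) h2.symm
  · intro y
    exact congrArg ψ (hF1 _)

omit [IsManifold (𝓡 4) ∞ M] in
/-- A symplectic diffeomorphism that maps `L₀` to `L₁` conjugates the monodromy groups. -/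
lemma conj_mem_monodromy {w : BilinForm M} {ψ : M ≃ₘ^∞⟮𝓡 4, 𝓡 4⟯ M} (hψ : PreservesForm w ψ)
    {L₀ L₁ : Set M} (h : L₀ ≃ₜ L₁) (hh : ∀ x, (h x : M) = ψ x) {g : H1 L₀ ≃ₗ[ℤ] H1 L₀}
    (hg : g ∈ monodromy w L₀) : conjEquiv (H1equiv h) g ∈ monodromy w L₁ := by
  obtain ⟨φ, ⟨hφ, -⟩, hL, hφg⟩ := hg
  have hsymm : ∀ y : L₁, ψ.symm y = h.symm y := by
    intro y
    obtain ⟨x, rfl⟩ := h.surjective y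
    rw [hh, ψ.symm_apply_apply, h.symm_apply_apply]
  have hψL : ψ '' L₀ = L₁ := by
    ext y
    constructor
    · rintro ⟨x, hx, rfl⟩
      rw [← hh ⟨x, hx⟩]
      exact (h ⟨x, hx⟩).2
    · intro hy
      refine ⟨h.symm ⟨y, hy⟩, (h.symm ⟨y, hy⟩).2, ?_⟩
      rw [← hh, h.apply_symm_apply]
  have hL' : ((ψ.symm.trans φ).trans ψ) '' L₁ = L₁ := by
    have h1 : ∀ S : Set M, ((ψ.symm.trans φ).trans ψ) '' S = ψ '' (φ '' (ψ.symm '' S)) := by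
      intro S
      rw [Set.image_image, Set.image_image]
      rfl
    have h2 : ψ.symm '' (ψ '' L₀) = L₀ := by
      rw [Set.image_image]
      simp
    rw [h1, ← hψL, h2, hL]
  refine ⟨(ψ.symm.trans φ).trans ψ, ⟨conj_mem_Ham hψ hφ, hL'⟩, hL', ?_⟩
  -- On `L₁` the conjugated diffeomorphism is `h ∘ φ ∘ h⁻¹`; functoriality of `H₁` then gives the
  -- conjugated automorphism.
  have hcomp : restrictTo ((ψ.symm.trans φ).trans ψ) L₁ hL' =
      (h : C(L₀, L₁)).comp ((restrictTo φ L₀ hL).comp (h.symm : C(L₁, L₀))) := by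
    ext y
    have h3 : ((restrictTo φ L₀ hL (h.symm y) : L₀) : M) = φ (h.symm y) := rfl
    change ψ (φ (ψ.symm y)) = (h (restrictTo φ L₀ hL (h.symm y)) : M)
    rw [hh, h3, hsymm]
  rw [hcomp, H1map_comp, H1map_comp, ← hφg]
  rfl

end Diffeomorphisms

/-! ### Tangent frames of embedded tori -/

section Immersion

variable {E E' E'' H H' : Type*} [NormedAddCommGroup E] [NormedSpace ℝ E] [NormedAddCommGroup E']
  [NormedSpace ℝ E'] [TopologicalSpace H] [TopologicalSpace H']
  {I : ModelWithCorners ℝ E H} {J : ModelWithCorners ℝ E' H'} [I.Boundaryless]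
  {N P : Type*} [TopologicalSpace N] [ChartedSpace H N] [TopologicalSpace P] [ChartedSpace H' P]
  {n : ℕ∞ω}

/-- The differential of an immersion is injective. -/
lemma mfderiv_injective_of_isImmersionAt {f : N → P} {x : N}
    (h : Manifold.IsImmersionAt I J n f x) (hn : n ≠ 0) :
    Function.Injective (mfderiv I J f x) := by
  -- A local left inverse of `f`: in the immersion charts `f` is `z ↦ (z, 0)`, and `g` projects to
  -- the first component.
  let g : P → N := fun y =>
    (h.domChart.extend I).symm (h.equiv.symm ((h.codChart.extend J) y)).1
  have hgf : ∀ y ∈ h.domChart.source, h.equiv.symm ((h.codChart.extend J) (f y)) =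
      ((h.domChart.extend I) y, 0) := by
    intro y hy
    have hy' : y ∈ (h.domChart.extend I).source := by rwa [OpenPartialHomeomorph.extend_source]
    have h1 := h.writtenInCharts ((h.domChart.extend I).map_source hy')
    simp only [Function.comp_apply, (h.domChart.extend I).left_inv hy'] at h1
    rw [h1, ContinuousLinearEquiv.symm_apply_apply]
  have hgf' : g ∘ f =ᶠ[nhds x] id := by
    filter_upwards [h.domChart.open_source.mem_nhds h.mem_domChart_source] with y hy
    have hy' : y ∈ (h.domChart.extend I).source := by rwa [OpenPartialHomeomorph.extend_source]
    simp only [g, Function.comp_apply, hgf y hy, (h.domChart.extend I).left_inv hy', id]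
  have hf : MDifferentiableAt I J f x := h.contMDiffAt.mdifferentiableAt hn
  have hcod : MDifferentiableAt J 𝓘(ℝ, E') (h.codChart.extend J) (f x) :=
    (h.codChart.contMDiffAt_extend h.codChart_mem_maximalAtlas
      h.mem_codChart_source).mdifferentiableAt hn
  have hx : x ∈ (h.domChart.extend I).source := by
    rw [OpenPartialHomeomorph.extend_source]
    exact h.mem_domChart_source
  have hdom : MDifferentiableAt 𝓘(ℝ, E) I (h.domChart.extend I).symm
      (h.equiv.symm ((h.codChart.extend J) (f x))).1 := by
    rw [hgf x h.mem_domChart_source]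
    refine ((contMDiffOn_extend_symm h.domChart_mem_maximalAtlas).contMDiffAt ?_).mdifferentiableAt
      hn
    rw [← h.domChart.extend_target']
    exact (h.domChart.isOpen_extend_target).mem_nhds ((h.domChart.extend I).map_source hx)
  have hlin : MDifferentiableAt 𝓘(ℝ, E') 𝓘(ℝ, E) (fun z => (h.equiv.symm z).1)
      ((h.codChart.extend J) (f x)) := by
    apply DifferentiableAt.mdifferentiableAt
    fun_prop
  have hg : MDifferentiableAt J I g (f x) := hdom.comp (f x) (hlin.comp (f x) hcod)
  have hcomp := mfderiv_comp x hg hf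
  rw [hgf'.mfderiv_eq, mfderiv_id] at hcomp
  intro u v huv
  have h1 := congrArg (fun L => L u) hcomp
  have h2 := congrArg (fun L => L v) hcomp
  simp only [ContinuousLinearMap.comp_apply] at h1 h2
  rw [huv, ← h2] at h1
  exact h1

end Immersion

/-! ### Left-invariant frames on the torus and their images under embeddings. -/

section Torus

/-- The model of the standard torus. -/
abbrev torusModel := (𝓡 1).prod (𝓡 1)

/-- The inclusion of the standard torus in `ℂ × ℂ`. -/
def torusIncl (p : Circle × Circle) : ℂ × ℂ := (p.1, p.2)

lemma contMDiff_torusIncl : ContMDiff torusModel 𝓘(ℝ, ℂ × ℂ) ∞ torusIncl := by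
  have hcoe : ContMDiff (𝓡 1) 𝓘(ℝ, ℂ) ∞ (fun z : Circle => (z : ℂ)) := by
    have : Fact (Module.finrank ℝ ℂ = 1 + 1) := ⟨Complex.finrank_real_complex⟩
    exact contMDiff_coe_sphere (n := 1) (E := ℂ)
  exact (hcoe.comp contMDiff_fst).prodMk_space (hcoe.comp contMDiff_snd)

/-- Invariant vector fields of a torus are velocities of the translates of curves. -/
lemma exists_invariant_direction {γ : ℝ → Circle × Circle} (hγ : ContMDiff 𝓘(ℝ, ℝ) torusModel ∞ γ)
    (h1 : γ 0 = 1) {d : ℂ × ℂ} (hd : HasDerivAt (torusIncl ∘ γ) d 0) :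
    ∃ v : GroupLieAlgebra torusModel (Circle × Circle),
      mfderiv torusModel 𝓘(ℝ, ℂ × ℂ) torusIncl 1 v = d ∧
      tangentMap 𝓘(ℝ, ℝ) torusModel γ ⟨0, (1 : ℝ)⟩ = ⟨1, v⟩ := by
  have key : ∀ p, γ 0 = p → ∃ v : TangentSpace torusModel p,
      mfderiv torusModel 𝓘(ℝ, ℂ × ℂ) torusIncl p v = d ∧
      tangentMap 𝓘(ℝ, ℝ) torusModel γ ⟨0, (1 : ℝ)⟩ = ⟨p, v⟩ := by
    rintro _ rfl
    refine ⟨mfderiv 𝓘(ℝ, ℝ) torusModel γ 0 (1 : ℝ), ?_, rfl⟩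
    have h2 := mfderiv_comp (0 : ℝ) (contMDiff_torusIncl.mdifferentiable (by simp) (γ 0))
      (hγ.mdifferentiable (by simp) 0)
    rw [mfderiv_eq_fderiv] at h2
    have h3 := congrArg (fun L => L (1 : ℝ)) h2
    refine h3.symm.trans ?_
    exact (fderiv_apply_one_eq_deriv (f := torusIncl ∘ γ) (x := (0 : ℝ))).trans hd.deriv
  exact key 1 h1

lemma mfderiv_mul_left_injective (z : Circle × Circle) :
    Function.Injective (mfderiv torusModel torusModel (fun p : Circle × Circle => z * p) 1) := by
  have hmul : ∀ z : Circle × Circle, ContMDiff torusModel torusModel ∞ (fun p => z * p) :=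
    fun z => contMDiff_mul_left
  have hcomp := mfderiv_comp (1 : Circle × Circle)
    ((hmul z⁻¹).mdifferentiable (by simp) (z * 1)) ((hmul z).mdifferentiable (by simp) 1)
  have hid : (fun p => z⁻¹ * p) ∘ (fun p : Circle × Circle => z * p) = id := by
    funext p
    exact inv_mul_cancel_left z p
  rw [hid, mfderiv_id] at hcomp
  have key := fun u : TangentSpace torusModel (1 : Circle × Circle) =>
    congrArg (fun L => L u) hcomp
  intro u v huv
  exact (key u).trans ((congrArg (mfderiv torusModel torusModel
    (fun p : Circle × Circle => z⁻¹ * p) (z * 1)) huv).trans (key v).symm)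

lemma linearIndependent_pair_map {V W : Type*} [AddCommGroup V] [Module ℝ V] [AddCommGroup W]
    [Module ℝ W] {a b : V} (h : LinearIndependent ℝ ![a, b]) (f : V →ₗ[ℝ] W)
    (hf : Function.Injective f) : LinearIndependent ℝ ![f a, f b] := by
  rw [LinearIndependent.pair_iff] at h ⊢
  intro x y hxy
  apply h
  apply hf
  simpa using hxy

/-- The velocities of the two coordinate circles at the identity; in `ℂ × ℂ` they become `(i, 0)`
and `(0, i)`. The curves are kept because tangency to `L` is defined by curves. -/
lemma exists_invariant_frame : ∃ (γ₁ γ₂ : ℝ → Circle × Circle)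
    (v₁ v₂ : GroupLieAlgebra torusModel (Circle × Circle)),
    ContMDiff 𝓘(ℝ, ℝ) torusModel ∞ γ₁ ∧ ContMDiff 𝓘(ℝ, ℝ) torusModel ∞ γ₂ ∧
    tangentMap 𝓘(ℝ, ℝ) torusModel γ₁ ⟨0, (1 : ℝ)⟩ = ⟨1, v₁⟩ ∧
    tangentMap 𝓘(ℝ, ℝ) torusModel γ₂ ⟨0, (1 : ℝ)⟩ = ⟨1, v₂⟩ ∧
    LinearIndependent ℝ ![v₁, v₂] := by
  have hexp : HasDerivAt (fun t : ℝ => ((Circle.exp t : Circle) : ℂ)) Complex.I 0 := by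
    have h1 : HasDerivAt (fun t : ℝ => Complex.exp (t * Complex.I)) Complex.I 0 := by
      have h2 : HasDerivAt (fun t : ℝ => (t : ℂ) * Complex.I) (1 * Complex.I) 0 :=
        (Complex.ofRealCLM.hasDerivAt (x := (0 : ℝ))).mul_const _
      simpa using h2.cexp
    exact h1.congr_of_eventuallyEq (Filter.Eventually.of_forall fun t => Circle.coe_exp t)
  have hone : HasDerivAt (fun _ : ℝ => ((1 : Circle) : ℂ)) 0 0 := hasDerivAt_const _ _
  have hγ₁ : ContMDiff 𝓘(ℝ, ℝ) torusModel ∞ (fun t : ℝ => (Circle.exp t, (1 : Circle))) :=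
    contMDiff_circleExp.prodMk contMDiff_const
  have hγ₂ : ContMDiff 𝓘(ℝ, ℝ) torusModel ∞ (fun t : ℝ => ((1 : Circle), Circle.exp t)) :=
    contMDiff_const.prodMk contMDiff_circleExp
  obtain ⟨v₁, hd₁, ht₁⟩ := exists_invariant_direction hγ₁ (by simp) (hexp.prodMk hone)
  obtain ⟨v₂, hd₂, ht₂⟩ := exists_invariant_direction hγ₂ (by simp) (hone.prodMk hexp)
  refine ⟨_, _, v₁, v₂, hγ₁, hγ₂, ht₁, ht₂, ?_⟩
  rw [LinearIndependent.pair_iff]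
  intro a b hab
  have h := congrArg (mfderiv torusModel 𝓘(ℝ, ℂ × ℂ) torusIncl 1) hab
  rw [map_add, map_smul, map_smul, map_zero, hd₁, hd₂] at h
  have h' : a • ((Complex.I, 0) : ℂ × ℂ) + b • ((0, Complex.I) : ℂ × ℂ) = 0 := h
  simpa using h'

variable {M : Type u} [TopologicalSpace M] [ChartedSpace E4 M] [IsManifold (𝓡 4) ∞ M]

/-- An embedded torus has a continuous tangent frame. -/
lemma exists_tangent_frame {e : Circle × Circle → M}
    (he : Manifold.IsSmoothEmbedding torusModel (𝓡 4) ∞ e) :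
    ∃ u v : ∀ z, TangentSpace (𝓡 4) (e z),
      Continuous (fun z => (⟨e z, u z⟩ : TangentBundle (𝓡 4) M)) ∧
      Continuous (fun z => (⟨e z, v z⟩ : TangentBundle (𝓡 4) M)) ∧
      (∀ z, IsTangentTo (Set.range e) (e z) (u z)) ∧
      (∀ z, IsTangentTo (Set.range e) (e z) (v z)) ∧
      ∀ z, LinearIndependent ℝ ![u z, v z] := by
  obtain ⟨γ₁, γ₂, v₁, v₂, hγ₁, hγ₂, ht₁, ht₂, hli⟩ := exists_invariant_frame
  have hLie : LieGroup torusModel (minSmoothness ℝ 3) (Circle × Circle) := by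
    infer_instance
  have he' := he.contMDiff
  have hcont : ∀ v : GroupLieAlgebra torusModel (Circle × Circle),
      Continuous (fun z => (⟨e z, mfderiv torusModel (𝓡 4) e z (mulInvariantVectorField v z)⟩ :
        TangentBundle (𝓡 4) M)) := fun v =>
    (he'.continuous_tangentMap (by simp)).comp (contMDiff_mulInvariantVectorField v).continuous
  have hmul : ∀ z : Circle × Circle, ContMDiff torusModel torusModel ∞ (fun p => z * p) :=
    fun z => contMDiff_mul_left
  have htan : ∀ (γ : ℝ → Circle × Circle) (v : GroupLieAlgebra torusModel (Circle × Circle)),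
      ContMDiff 𝓘(ℝ, ℝ) torusModel ∞ γ →
      tangentMap 𝓘(ℝ, ℝ) torusModel γ ⟨0, (1 : ℝ)⟩ = ⟨1, v⟩ → ∀ z,
      IsTangentTo (Set.range e) (e z)
        (mfderiv torusModel (𝓡 4) e z (mulInvariantVectorField v z)) := by
    intro γ v hγ ht z
    -- The invariant field at `z` is the velocity of the translated curve `z γ(t)`.
    refine ⟨fun t => e (z * γ t), he'.comp ((hmul z).comp hγ), fun t => ⟨_, rfl⟩, ?_⟩
    have h1 := tangentMap_comp_at (I := 𝓘(ℝ, ℝ)) (I' := torusModel) (I'' := 𝓡 4)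
      (g := e) (f := fun t => z * γ t) ⟨0, (1 : ℝ)⟩
      (he'.mdifferentiable (by simp) _) (((hmul z).comp hγ).mdifferentiable (by simp) _)
    have h2 := tangentMap_comp_at (I := 𝓘(ℝ, ℝ)) (I' := torusModel) (I'' := torusModel)
      (g := fun p => z * p) (f := γ) ⟨0, (1 : ℝ)⟩
      ((hmul z).mdifferentiable (by simp) _) (hγ.mdifferentiable (by simp) _)
    have h3 : tangentMap torusModel torusModel (fun p => z * p) ⟨1, v⟩ =
        ⟨z, mulInvariantVectorField v z⟩ := Bundle.TotalSpace.ext (mul_one z) HEq.rfl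
    refine h1.trans ?_
    refine (congrArg (tangentMap torusModel (𝓡 4) e) (h2.trans ?_)).trans
      (b := tangentMap torusModel (𝓡 4) e ⟨z, mulInvariantVectorField v z⟩) rfl
    rw [ht, h3]
  refine ⟨_, _, hcont v₁, hcont v₂, htan γ₁ v₁ hγ₁ ht₁, htan γ₂ v₂ hγ₂ ht₂, fun z => ?_⟩
  let A : TangentSpace torusModel z →L[ℝ] TangentSpace (𝓡 4) (e z) := mfderiv torusModel (𝓡 4) e z
  let B : TangentSpace torusModel (1 : Circle × Circle) →L[ℝ] TangentSpace torusModel z :=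
    mfderiv torusModel torusModel (fun p : Circle × Circle => z * p) 1
  have hA : Function.Injective A :=
    mfderiv_injective_of_isImmersionAt (he.isImmersion.isImmersionAt z) (by simp)
  have hB : Function.Injective B := mfderiv_mul_left_injective z
  exact linearIndependent_pair_map hli (A ∘L B).toLinearMap (hA.comp hB)

end Torus

/-! ### Uniqueness and invariance of the Maslov class -/

section Maslov

/-- The phase of a nowhere vanishing complex function. -/
lemma exists_phase {X : Type*} [TopologicalSpace X] {ρ : X → ℂ} (hρ : Continuous ρ)
    (hne : ∀ x, ρ x ≠ 0) : ∃ g : C(X, Circle), ∀ x, (g x : ℂ) = ρ x / ‖ρ x‖ := by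
  have hnorm : ∀ x, (‖ρ x‖ : ℂ) ≠ 0 := fun x => by simpa using hne x
  have hmem : ∀ x, ρ x / ‖ρ x‖ ∈ Submonoid.unitSphere ℂ := by
    intro x
    apply mem_sphere_zero_iff_norm.2
    rw [norm_div, Complex.norm_real, norm_norm, div_self (norm_ne_zero_iff.2 (hne x))]
  refine ⟨⟨fun x => ⟨ρ x / ‖ρ x‖, hmem x⟩, ?_⟩, fun x => rfl⟩
  exact Continuous.subtype_mk (hρ.div (Complex.continuous_ofReal.comp hρ.norm) hnorm) hmem

lemma phase_relation {κ s ρ t : ℂ} (hκ : κ ≠ 0) (h : κ * s = ρ * t) :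
    Complex.exp (κ.arg * Complex.I) ^ 2 * (s / ‖s‖) ^ 2 = (ρ / ‖ρ‖) ^ 2 * (t / ‖t‖) ^ 2 := by
  have h1 : Complex.exp (κ.arg * Complex.I) = κ / ‖κ‖ := by
    rw [eq_div_iff (by simpa using hκ), mul_comm]
    exact Complex.norm_mul_exp_arg_mul_I κ
  have h2 : (‖κ‖ : ℂ) * ‖s‖ = ‖ρ‖ * ‖t‖ := by
    rw [← Complex.ofReal_mul, ← Complex.ofReal_mul, ← norm_mul, ← norm_mul, h]
  rw [h1, ← mul_pow, ← mul_pow, div_mul_div_comm, div_mul_div_comm, h, h2]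

variable {M : Type u} [TopologicalSpace M] [ChartedSpace E4 M] [IsManifold (𝓡 4) ∞ M]

/-- `θ` is the squared phase of `s` on the tangent planes of `L`. -/
def IsSquaredPhase (s : ComplexBilinForm M) (L : Set M) (θ : C(L, Circle)) : Prop :=
  ∀ (x : L) (u v : TangentSpace (𝓡 4) (x : M)), IsTangentTo L x u → IsTangentTo L x v →
    LinearIndependent ℝ ![u, v] → (θ x : ℂ) = (s x u v / ‖s x u v‖) ^ 2

/-- The cochain `D` measures the total variation of `θ` along paths, in full turns. -/
def IsVariation {X : Type u} [TopologicalSpace X] (θ : C(X, Circle))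
    (D : (SingChains X).X 1 →ₗ[ℤ] ℝ) : Prop :=
  ∀ σ : C(Edge, X), ∃ f : C(Edge, ℝ), (∀ p, Circle.exp (2 * Real.pi * f p) = θ (σ p)) ∧
    D (edgeChain σ) = f (stdSimplex.vertex 1) - f (stdSimplex.vertex 0)

/-- The squared phases of two area forms differ by the restriction of a circle valued function on
`M` and by the exponential of a real function. -/
lemma IsContinuousAreaForm.exists_phase_relation {w : BilinForm M} (hw : ∀ x v, w x v v = 0)
    {L : Set M} (hL : IsLagrangianTorus w L)
    {J₀ J₁ : ∀ x : M, TangentSpace (𝓡 4) x →L[ℝ] TangentSpace (𝓡 4) x}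
    {s₀ s₁ : ComplexBilinForm M} (h₀ : IsContinuousAreaForm w J₀ s₀)
    (h₁ : IsContinuousAreaForm w J₁ s₁) {θ₀ θ₁ : C(L, Circle)} (hθ₀ : IsSquaredPhase s₀ L θ₀)
    (hθ₁ : IsSquaredPhase s₁ L θ₁) :
    ∃ (g : C(M, Circle)) (a : L → ℝ), Continuous a ∧
      ∀ x : L, Circle.exp (a x) ^ 2 * θ₁ x = g x ^ 2 * θ₀ x := by
  obtain ⟨⟨e, he, rfl⟩, hLag⟩ := hL
  obtain ⟨u, v, huc, hvc, hu, hv, hli⟩ := exists_tangent_frame he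
  obtain ⟨ρ, hρc, hρ, hρs⟩ := h₀.exists_ratio hw h₁
  obtain ⟨g, hg⟩ := exists_phase hρc hρ
  let κ : Circle × Circle → ℂ := fun z =>
    twoZeroPart (J₀ (e z)) (s₁ (e z)) (u z) (v z) / s₁ (e z) (u z) (v z)
  have hLagz : ∀ z, w (e z) (u z) (v z) = 0 := fun z => hLag _ ⟨z, rfl⟩ _ _ (hu z) (hv z)
  have hs₁ : ∀ z, s₁ (e z) (u z) (v z) ≠ 0 := fun z =>
    (h₁.areaForm _).ne_zero_of_isComplexBasis (h₁.nonvanishing _)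
      ((h₁.compatible _).isComplexBasis (finrank_tangentSpace _) (hw _) (hli z) (hLagz z))
  have hκ : ∀ z, κ z ∈ Complex.slitPlane := fun z =>
    twoZeroPart_div_mem_slitPlane (finrank_tangentSpace _) (hw _) (h₀.compatible _)
      (h₁.compatible _) (h₁.areaForm _) (hli z) (hLagz z) (hs₁ z)
  have hκc : Continuous κ := by
    rw [continuous_iff_continuousAt]
    intro z
    exact (h₀.continuousAt_twoZeroPart h₁ huc.continuousAt hvc.continuousAt).div
      (h₁.continuousAt_apply huc.continuousAt hvc.continuousAt) (hs₁ z)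
  -- Here the slit plane is essential: the principal argument is continuous on it, so the phase of
  -- `κ` has a global real lift on the torus.
  have hargc : Continuous fun z => (κ z).arg := by
    rw [continuous_iff_continuousAt]
    intro z
    exact (Complex.continuousAt_arg (hκ z)).comp hκc.continuousAt
  let h : Circle × Circle ≃ₜ Set.range e := he.isEmbedding.toHomeomorph
  refine ⟨g, fun x => (κ (h.symm x)).arg, hargc.comp h.symm.continuous, fun x => ?_⟩
  obtain ⟨z, rfl⟩ := h.surjective x
  beta_reduce
  rw [h.symm_apply_apply]
  have e₀ := hθ₀ ⟨e z, z, rfl⟩ (u z) (v z) (hu z) (hv z) (hli z)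
  have e₁ := hθ₁ ⟨e z, z, rfl⟩ (u z) (v z) (hu z) (hv z) (hli z)
  have hrel := phase_relation (Complex.slitPlane_ne_zero (hκ z))
    (show κ z * s₁ (e z) (u z) (v z) = ρ (e z) * s₀ (e z) (u z) (v z) by
      rw [← hρs, div_mul_cancel₀ _ (hs₁ z)])
  rw [← e₀, ← e₁, ← hg, ← Circle.coe_exp] at hrel
  exact Circle.ext hrel

/-- The Maslov class does not depend on the complex structure and the area form. -/
theorem maslovClass_unique (hM : RealH1Vanishes M) {w : BilinForm M} (hw : ∀ x v, w x v v = 0)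
    {L : Set M} (hL : IsLagrangianTorus w L)
    {J₀ J₁ : ∀ x : M, TangentSpace (𝓡 4) x →L[ℝ] TangentSpace (𝓡 4) x}
    {s₀ s₁ : ComplexBilinForm M} (h₀ : IsContinuousAreaForm w J₀ s₀)
    (h₁ : IsContinuousAreaForm w J₁ s₁) {θ₀ θ₁ : C(L, Circle)} (hθ₀ : IsSquaredPhase s₀ L θ₀)
    (hθ₁ : IsSquaredPhase s₁ L θ₁) {D₀ D₁ : (SingChains L).X 1 →ₗ[ℤ] ℝ}
    (hD₀ : IsVariation θ₀ D₀) (hD₁ : IsVariation θ₁ D₁) {μ₀ μ₁ : H1 L →ₗ[ℤ] ℤ}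
    (hμ₀ : IsRepresentedBy ((Int.castAddHom ℝ).toIntLinearMap ∘ₗ μ₀) D₀)
    (hμ₁ : IsRepresentedBy ((Int.castAddHom ℝ).toIntLinearMap ∘ₗ μ₁) D₁) : μ₀ = μ₁ := by
  obtain ⟨g, a, hac, hrel⟩ := h₀.exists_phase_relation hw hL h₁ hθ₀ hθ₁
  obtain ⟨F, hF⟩ := hM.exists_primitive g
  let incl : C(L, M) := ⟨Subtype.val, continuous_subtype_val⟩
  -- From `exp(a)² θ₁ = g² θ₀`, lifts counted in full turns satisfy `f₁ = f₀ + 2 f - a / π` up to a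
  -- constant; `F` is the primitive of the variation of `g`.
  let G : L → ℝ := fun x => 2 * F x - Real.pi⁻¹ * a x
  have hvar : ∀ σ : C(Edge, L), (D₁ - D₀) (edgeChain σ) =
      G (σ (stdSimplex.vertex 1)) - G (σ (stdSimplex.vertex 0)) := by
    intro σ
    obtain ⟨f₀, hf₀, hd₀⟩ := hD₀ σ
    obtain ⟨f₁, hf₁, hd₁⟩ := hD₁ σ
    obtain ⟨f, hf, hd⟩ := hF (incl.comp σ)
    have hd' : f (stdSimplex.vertex 1) - f (stdSimplex.vertex 0) =
        F (σ (stdSimplex.vertex 1)) - F (σ (stdSimplex.vertex 0)) := hd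
    have key := lift_sub_eq (f := f₁) (f' := fun p => f₀ p + 2 * f p - Real.pi⁻¹ * a (σ p))
      f₁.continuous (by fun_prop) (fun p => by
        have hp : 2 * Real.pi * (f₀ p + 2 * f p - Real.pi⁻¹ * a (σ p)) =
            2 * Real.pi * f₀ p + (2 * Real.pi * f p + 2 * Real.pi * f p) -
              (a (σ p) + a (σ p)) := by
          field_simp
          ring
        have hfp : Circle.exp (2 * Real.pi * f p) = g (σ p) := hf p
        rw [hp, Circle.exp_sub, Circle.exp_add, Circle.exp_add, Circle.exp_add, hf₀, hf₁, hfp,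
          eq_div_iff_mul_eq', ← pow_two, ← pow_two,
          mul_comm (θ₁ (σ p)), hrel, mul_comm])
      (stdSimplex.vertex 1) (stdSimplex.vertex 0)
    rw [LinearMap.sub_apply, hd₁, hd₀, key]
    simp only [G]
    linear_combination 2 * hd'
  have hcast := hμ₀.ext hμ₁ fun z => by
    have := eq_zero_on_cycles G hvar z
    rw [LinearMap.sub_apply, sub_eq_zero] at this
    exact this.symm
  ext η
  have := congrArg (fun k => k η) hcast
  exact Int.cast_injective (α := ℝ) this

/-- Symplectic diffeomorphisms intertwine the Maslov classes. -/
theorem maslovClass_comp (hM : RealH1Vanishes M) {w : BilinForm M} (hw : ∀ x v, w x v v = 0)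
    {L₀ L₁ : Set M} (hL : IsLagrangianTorus w L₀) {μ₀ : H1 L₀ →ₗ[ℤ] ℤ} {μ₁ : H1 L₁ →ₗ[ℤ] ℤ}
    (hμ₀ : IsMaslovClass w L₀ μ₀) (hμ₁ : IsMaslovClass w L₁ μ₁) {ψ : M ≃ₘ^∞⟮𝓡 4, 𝓡 4⟯ M}
    (hψ : PreservesForm w ψ) (hψL : ψ '' L₀ = L₁) (h : L₀ ≃ₜ L₁) (hh : ∀ x, (h x : M) = ψ x) :
    μ₁ ∘ₗ H1map h = μ₀ := by
  obtain ⟨J₀, s₀, θ₀, D₀, hJ₀, hs₀, hθ₀, hD₀, hr₀⟩ := hμ₀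
  obtain ⟨J₁, s₁, θ₁, D₁, hJ₁, hs₁, hθ₁, hD₁, hr₁⟩ := hμ₁
  -- The pulled back data have squared phase `θ₁ ∘ h` on `L₀`, because the differential of `ψ` maps
  -- tangent vectors of `L₀` to tangent vectors of `L₁`. Both classes are thus computed on `L₀`,
  -- where uniqueness applies.
  refine maslovClass_unique hM hw hL
    ((IsContinuousAreaForm.of_isCompatible hJ₁ hs₁).pullback hψ)
    (IsContinuousAreaForm.of_isCompatible hJ₀ hs₀) (θ₀ := θ₁.comp (h : C(L₀, L₁))) ?_ hθ₀
    (D₀ := D₁ ∘ₗ chainMap (h : C(L₀, L₁))) ?_ hD₀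
    (hr₁.comp (h : C(L₀, L₁))) hr₀
  · intro x u v hu hv hli
    have hx : h x = ⟨ψ x, hψL ▸ ⟨x, x.2, rfl⟩⟩ := Subtype.ext (hh x)
    rw [ContinuousMap.comp_apply]
    refine (congrArg (fun y => (θ₁ y : ℂ)) hx).trans ?_
    have hu' := hu.map ψ
    have hv' := hv.map ψ
    rw [hψL] at hu' hv'
    exact hθ₁ ⟨ψ x, _⟩ (diffEquiv ψ x u) (diffEquiv ψ x v) hu' hv'
      (linearIndependent_pair_map hli (diffEquiv ψ (x : M)).toLinearEquiv.toLinearMap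
        (diffEquiv ψ (x : M)).injective)
  · intro σ
    obtain ⟨f, hf, hd⟩ := hD₁ ((h : C(L₀, L₁)).comp σ)
    refine ⟨f, hf, ?_⟩
    rw [LinearMap.comp_apply, chainMap_edgeChain, hd]

/-- The default value is `0`, so a nonzero value must come from an actual Maslov class. -/
lemma isMaslovClass_maslovClass {w : BilinForm M} {L : Set M} (h : maslovClass w L ≠ 0) :
    IsMaslovClass w L (maslovClass w L) := by
  unfold maslovClass at h ⊢
  split_ifs at h ⊢ with hex
  · exact hex.choose_spec
  · exact absurd rfl h

/-- The twist number and the spectrum are invariant under symplectic diffeomorphisms. -/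
theorem invariants_eq_of_preservesForm (hM : RealH1Vanishes M) {w : BilinForm M}
    (hw : ∀ x v, w x v v = 0) {L₀ : Set M} {ψ : M ≃ₘ^∞⟮𝓡 4, 𝓡 4⟯ M} (hψ : PreservesForm w ψ)
    (h₀ : IsMonotoneLagrangianTorus w L₀) (h₁ : IsMonotoneLagrangianTorus w (ψ '' L₀)) :
    twistNumber w L₀ = twistNumber w (ψ '' L₀) ∧
      spectrumNumber w L₀ = spectrumNumber w (ψ '' L₀) := by
  let h : L₀ ≃ₜ ψ '' L₀ := ψ.toHomeomorph.image L₀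
  have hh : ∀ x, (h x : M) = ψ x := fun _ => rfl
  have hh' : ∀ y, (h.symm y : M) = ψ.symm y := by
    intro y
    obtain ⟨x, rfl⟩ := h.surjective y
    rw [hh, ψ.symm_apply_apply, h.symm_apply_apply]
  have hcomp := maslovClass_comp hM hw h₀.lagrangian (isMaslovClass_maslovClass h₀.maslov_ne_zero)
    (isMaslovClass_maslovClass h₁.maslov_ne_zero) hψ rfl h hh
  have hμ : ∀ η, maslovClass w (ψ '' L₀) (H1equiv h η) = maslovClass w L₀ η :=
    fun η => congrArg (fun k => k η) hcomp
  have hG : ∀ g ∈ monodromy w L₀, conjEquiv (H1equiv h) g ∈ monodromy w (ψ '' L₀) :=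
    fun g hg => conj_mem_monodromy hψ h hh hg
  have hG' : ∀ g ∈ monodromy w (ψ '' L₀), conjEquiv (H1equiv h).symm g ∈ monodromy w L₀ :=
    fun g hg => conj_mem_monodromy hψ.symm h.symm hh' hg
  exact ⟨twistNumberOf_congr (H1equiv h) hμ hG hG', spectrumOf_congr (H1equiv h) hμ hG hG'⟩

end Maslov

end LagrangianMonodromy

end

theorem lemma2p13 {M : Type u} [TopologicalSpace M] [T2Space M] [SecondCountableTopology M]
    [ChartedSpace LagrangianMonodromy.E4 M] [IsManifold (𝓡 4) ∞ M]
    (w : LagrangianMonodromy.BilinForm M) (hw : LagrangianMonodromy.IsSymplectic w)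
    (hc : LagrangianMonodromy.FirstChernClassVanishes w)
    (hH : LagrangianMonodromy.RealH1Vanishes M)
    (L₀ L₁ : Set M)
    (h₀ : LagrangianMonodromy.IsMonotoneLagrangianTorus w L₀)
    (h₁ : LagrangianMonodromy.IsMonotoneLagrangianTorus w L₁)
    (hiso : LagrangianMonodromy.HamiltonianIsotopic w L₀ L₁) :
    LagrangianMonodromy.twistNumber w L₀ = LagrangianMonodromy.twistNumber w L₁ ∧
      LagrangianMonodromy.spectrumNumber w L₀ = LagrangianMonodromy.spectrumNumber w L₁ := by
  obtain ⟨Φ, -, -, hΦ, -, rfl⟩ := hiso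
  exact LagrangianMonodromy.invariants_eq_of_preservesForm hH hw.alternating
    (hΦ 1 (Set.right_mem_Icc.2 zero_le_one)).1 h₀ h₁
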